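/- Let $\mathbb{C}_R=\{s\in\mathbb{C}:\operatorname{Re}s>0\}$. An $m\times m$-valued rational function $F(s)$ with complex coefficients is called - \emph{positive real} if $F$ is analytic in $\mathbb{C}_R$ and $F(s)+F(s)^*$ is positive semidefinite for all $s\in\mathbb{C}_R$; - \emph{strictly positive real} if $F(s-\epsilon)$ is positive real for some $\epsilon>0$; - \emph{hyper-positive real} if $F$ is analytic on the closed right half-plane including the point at infinity, and $F(s)+F(s)^*$ is positive definite at every point of it; that is, $F$ has no pole $s$ with $\operatorname{Re}s\ge 0$, $F(s)+F(s)^*$ is positive definite whenever $\operatorname{Re}s\ge0$, and the limit $F(\infty)=\lim_{s\to\infty}F(s)$ exists and $F(\infty)+F(\infty)^*$ is positive definite. **Theorem.** Let $F(s)$ be an $m\times m$-valued rational function with no pole at infinity, and let $A\in\mathbb{C}^{n\times n}$, $B\in\mathbb{C}^{n\times m}$, $C\in\mathbb{C}^{m\times n}$, $D\in\mathbb{C}^{m\times m}$ be a state-space realization of it, i.e. $F(s)=C(sI_n-A)^{-1}B+D$. For a positive definite Hermitian $H\in\mathbb{C}^{n\times n}$ put $$Q=Q(H)=\begin{pmatrix}-H&0\\0&I_m\end{pmatrix}\begin{pmatrix}A&B\\C&D\end{pmatrix}+\begin{pmatrix}A&B\\C&D\end{pmatrix}^*\begin{pmatrix}-H&0\\0&I_m\end{pmatrix}.$$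 (i) If $Q(H)$ is positive semidefinite for some positive definite $H$, then $F$ is positive real. (ii) If for some positive definite $H$ one has $Q(H)=Q_1+\begin{pmatrix}\Delta&0\\0&0\end{pmatrix}$ with $Q_1\in\mathbb{C}^{(n+m)\times(n+m)}$ positive semidefinite and $\Delta\in\mathbb{C}^{n\times n}$ positive definite, then $F$ is strictly positive real. (iii) If $Q(H)$ is positive definite for some positive definite $H$, then $F$ is hyper-positive real. Moreover, if the realization is minimal, i.e. $n$ is the McMillan degree of $F$ (the least state dimension of a realization of $F$), then the converse of each of the three statements holds: if $F$ is positive real (respectively strictly positive real, hyper-positive real), then there is a positive definite $H$ satisfying the condition in (i) (respectively (ii), (iii)). -/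

import Mathlib

open scoped ComplexOrder Topology

noncomputable section

namespace KYP

/-- An `m × m`-valued rational function with complex coefficients. -/
abbrev RatMat (m : ℕ) : Type := Matrix (Fin m) (Fin m) (RatFunc ℂ)

/-- The value `F(s)` (meaningful when `s` is not a pole of `F`). -/
def RatMat.value {m : ℕ} (F : RatMat m) (s : ℂ) : Matrix (Fin m) (Fin m) ℂ :=
  F.map (RatFunc.eval (RingHom.id ℂ) s)

/-- `F` is analytic at `s ∈ ℂ`: no entry has a pole there, that is, the denominators of the
entries in lowest terms do not vanish at `s`. -/
def RatMat.AnalyticAtPoint {m : ℕ} (F : RatMat m) (s : ℂ) : Prop :=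
  ∀ i j, (F i j).denom.eval s ≠ 0

/-- The rational function `s ↦ F(s - ε)`, obtained by substituting `X - ε` for `X`. -/
def RatMat.shift {m : ℕ} (F : RatMat m) (ε : ℝ) : RatMat m :=
  F.map (RatFunc.eval RatFunc.C (RatFunc.X - RatFunc.C (ε : ℂ)))

/-- The closed set of matrices `M` with `M + M*` positive semidefinite. -/
def lyapClosed (m : ℕ) : Set (Matrix (Fin m) (Fin m) ℂ) :=
  {M | (M + M.conjTranspose).PosSemidef}

/-- The open set of matrices `M` with `M + M*` positive definite. -/
def lyapOpen (m : ℕ) : Set (Matrix (Fin m) (Fin m) ℂ) :=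
  {M | (M + M.conjTranspose).PosDef}

/-- Positive real: `F` maps the open right half-plane analytically to `lyapClosed`. -/
def IsPositiveReal {m : ℕ} (F : RatMat m) : Prop :=
  ∀ s : ℂ, 0 < s.re → F.AnalyticAtPoint s ∧ F.value s ∈ lyapClosed m

/-- Strictly positive real: `F(s - ε)` is positive real for some `ε > 0`. -/
def IsStrictlyPositiveReal {m : ℕ} (F : RatMat m) : Prop :=
  ∃ ε : ℝ, 0 < ε ∧ IsPositiveReal (F.shift ε)

/-- Hyper-positive real: `F` maps the closed right half-plane, including the point at infinity,
analytically to `lyapOpen`. -/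
def IsHyperPositiveReal {m : ℕ} (F : RatMat m) : Prop :=
  (∀ s : ℂ, 0 ≤ s.re → F.AnalyticAtPoint s ∧ F.value s ∈ lyapOpen m) ∧
    ∃ L ∈ lyapOpen m, Filter.Tendsto F.value (Bornology.cobounded ℂ) (𝓝 L)

/-- `(A, B, C, D)` is a state-space realization of `F` of dimension `n`: the identity
`F(s) = C (s I - A)⁻¹ B + D` holds between matrices of rational functions in `s`.
In particular `F` then has no pole at infinity. -/
def IsRealization {n m : ℕ} (F : RatMat m)
    (A : Matrix (Fin n) (Fin n) ℂ) (B : Matrix (Fin n) (Fin m) ℂ)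
    (C : Matrix (Fin m) (Fin n) ℂ) (D : Matrix (Fin m) (Fin m) ℂ) : Prop :=
  F = C.map (RatFunc.C : ℂ →+* RatFunc ℂ) *
      ((RatFunc.X : RatFunc ℂ) • (1 : Matrix (Fin n) (Fin n) (RatFunc ℂ)) - A.map (RatFunc.C : ℂ →+* RatFunc ℂ))⁻¹ *
      B.map (RatFunc.C : ℂ →+* RatFunc ℂ) + D.map (RatFunc.C : ℂ →+* RatFunc ℂ)

/-- The McMillan degree: the least state dimension of a realization of `F` (used only for
functions that have a realization). -/
def mcMillanDegree {m : ℕ} (F : RatMat m) : ℕ :=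
  sInf {k : ℕ | ∃ (A : Matrix (Fin k) (Fin k) ℂ) (B : Matrix (Fin k) (Fin m) ℂ)
    (C : Matrix (Fin m) (Fin k) ℂ) (D : Matrix (Fin m) (Fin m) ℂ), IsRealization F A B C D}

/-- The `(n+m) × (n+m)` matrix `diag(-H, I) R + R* diag(-H, I)` with `R = [A, B; C, D]`. -/
def lyapunovMatrix {n m : ℕ} (H : Matrix (Fin n) (Fin n) ℂ)
    (A : Matrix (Fin n) (Fin n) ℂ) (B : Matrix (Fin n) (Fin m) ℂ)
    (C : Matrix (Fin m) (Fin n) ℂ) (D : Matrix (Fin m) (Fin m) ℂ) :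
    Matrix (Fin n ⊕ Fin m) (Fin n ⊕ Fin m) ℂ :=
  Matrix.fromBlocks (-H) 0 0 1 * Matrix.fromBlocks A B C D +
    (Matrix.fromBlocks A B C D).conjTranspose * Matrix.fromBlocks (-H) 0 0 1

end KYP

end

/-! Everything rests on one dissipation identity. If `A x + B u = s x`, the quadratic form of
`lyapunovMatrix H` at `(x, u)` equals `2 Re u*(C x + D u) - 2 Re s · x*Hx`, and `C x + D u = F(s) u`
whenever `s` is not an eigenvalue of `A`. Positivity of the form then bounds `Re u*F(s)u` from
below, and the choice `u = 0` excludes eigenvalues in the half-plane. The strict case reduces to the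
positive real one, because replacing `A` by `A + ε` subtracts `2εH` from the upper left block.

The converses come from convex duality. The form is affine in `H`, so by
`exists_lt_of_forall_eq_zero` a Hermitian `H` making it positive definite exists once `tr (M W) > 0`
for every nonzero `W ≥ 0` killed by `lyapDual`, where `M` is the matrix at `H = 0`. By
`exists_decomposition` such a `W` is a sum of terms `v v*`, where `v` is either a pair `(x, u)` with
`A x + B u = iω x` or a vector `(0, u)`. The inequalities for `F` on the imaginary axis and at
infinity are thus exactly what is needed (`exists_lyapunovMatrix_posDef`).

Minimality gives controllability and observability, hence every eigenvalue of `A` is a pole of `F`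
(`IsRealization.not_analyticAtPoint`). When `A` is stable, Lyapunov's theorem makes `H`
semidefinite, and observability makes it definite. For merely positive real `F` the strict result is
applied to `A - ε`, `D + ε`; the solutions are normalized and a limit is taken, with controllability
preventing degeneration. -/

namespace KYP

open Matrix

variable {n m k : ℕ}

/-! ### The dissipation identity -/

/-- The quadratic form of `lyapunovMatrix` at `(x, u)`, in terms of `A x + B u` and `C x + D u`. -/
lemma star_dotProduct_lyapunovMatrix_mulVec (H A : Matrix (Fin n) (Fin n) ℂ)
    (B : Matrix (Fin n) (Fin m) ℂ) (C : Matrix (Fin m) (Fin n) ℂ) (D : Matrix (Fin m) (Fin m) ℂ)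
    (x : Fin n → ℂ) (u : Fin m → ℂ) :
    star (Sum.elim x u) ⬝ᵥ (lyapunovMatrix H A B C D *ᵥ Sum.elim x u) =
      star u ⬝ᵥ (C *ᵥ x + D *ᵥ u) + star (C *ᵥ x + D *ᵥ u) ⬝ᵥ u -
        (star x ⬝ᵥ H *ᵥ (A *ᵥ x + B *ᵥ u) + star (A *ᵥ x + B *ᵥ u) ⬝ᵥ H *ᵥ x) := by
  have hs : ∀ (a : Fin n → ℂ) (b : Fin m → ℂ), star (Sum.elim a b) = Sum.elim (star a) (star b) := by
    intro a b; ext i; cases i <;> rfl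
  rw [lyapunovMatrix, add_mulVec, dotProduct_add, ← mulVec_mulVec, ← mulVec_mulVec,
    dotProduct_mulVec (star _) (fromBlocks A B C D)ᴴ, vecMul_conjTranspose, star_star]
  simp only [fromBlocks_mulVec, Sum.elim_comp_inl, Sum.elim_comp_inr, hs,
    sumElim_dotProduct_sumElim, zero_mulVec, neg_mulVec, add_zero, zero_add, one_mulVec,
    dotProduct_neg]
  ring

lemma lyapunovMatrix_isHermitian {H : Matrix (Fin n) (Fin n) ℂ} (hH : H.IsHermitian)
    (A : Matrix (Fin n) (Fin n) ℂ)
    (B : Matrix (Fin n) (Fin m) ℂ) (C : Matrix (Fin m) (Fin n) ℂ) (D : Matrix (Fin m) (Fin m) ℂ) :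
    (lyapunovMatrix H A B C D).IsHermitian := by
  have hK : (fromBlocks (-H) 0 0 (1 : Matrix (Fin m) (Fin m) ℂ))ᴴ = fromBlocks (-H) 0 0 1 := by
    rw [fromBlocks_conjTranspose]; simp [hH.eq]
  rw [IsHermitian, lyapunovMatrix, conjTranspose_add, conjTranspose_mul, conjTranspose_mul,
    conjTranspose_conjTranspose, hK, add_comm]

lemma sumElim_comp_inl_inr (w : Fin n ⊕ Fin m → ℂ) :
    Sum.elim (w ∘ Sum.inl) (w ∘ Sum.inr) = w := by
  ext i; cases i <;> rfl

/-- Dissipation identity on the trajectory `e^{st}`. -/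
lemma star_dotProduct_lyapunovMatrix_mulVec_of_eq_smul (H A : Matrix (Fin n) (Fin n) ℂ)
    (B : Matrix (Fin n) (Fin m) ℂ) (C : Matrix (Fin m) (Fin n) ℂ) (D : Matrix (Fin m) (Fin m) ℂ)
    {x : Fin n → ℂ} {u : Fin m → ℂ} {s : ℂ} (h : A *ᵥ x + B *ᵥ u = s • x) :
    star (Sum.elim x u) ⬝ᵥ (lyapunovMatrix H A B C D *ᵥ Sum.elim x u) =
      star u ⬝ᵥ (C *ᵥ x + D *ᵥ u) + star (C *ᵥ x + D *ᵥ u) ⬝ᵥ u -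
        2 * (s.re : ℂ) * (star x ⬝ᵥ H *ᵥ x) := by
  rw [star_dotProduct_lyapunovMatrix_mulVec, h, mulVec_smul, dotProduct_smul, star_smul,
    smul_dotProduct, smul_eq_mul, smul_eq_mul]
  have : (2 * (s.re : ℂ)) = s + star s := by
    rw [Complex.star_def, Complex.add_conj]; push_cast; ring
  rw [this]; ring

lemma star_dotProduct_add_conjTranspose_mulVec (M : Matrix (Fin m) (Fin m) ℂ) (u : Fin m → ℂ) :
    star u ⬝ᵥ ((M + Mᴴ) *ᵥ u) = star u ⬝ᵥ M *ᵥ u + star (M *ᵥ u) ⬝ᵥ u := by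
  rw [add_mulVec, dotProduct_add, dotProduct_mulVec (star u) Mᴴ, vecMul_conjTranspose, star_star]

lemma isHermitian_add_conjTranspose (M : Matrix (Fin m) (Fin m) ℂ) : (M + Mᴴ).IsHermitian := by
  rw [IsHermitian, conjTranspose_add, conjTranspose_conjTranspose, add_comm]

lemma star_dotProduct_add_star_dotProduct (u z : Fin m → ℂ) :
    star u ⬝ᵥ z + star z ⬝ᵥ u = ((2 * (star u ⬝ᵥ z).re : ℝ) : ℂ) := by
  have : star z ⬝ᵥ u = star (star u ⬝ᵥ z) := by rw [star_dotProduct]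
  rw [this, Complex.star_def, Complex.add_conj]

/-! ### Positive semidefinite solutions of the dual Lyapunov equation -/

lemma exists_unitary_diagonalization {ι : Type*} [Fintype ι] [DecidableEq ι] {W : Matrix ι ι ℂ}
    (hW : W.IsHermitian) :
    ∃ (V : Matrix ι ι ℂ) (d : ι → ℝ), V * Vᴴ = 1 ∧ Vᴴ * V = 1 ∧
      W = V * diagonal (fun i => (d i : ℂ)) * Vᴴ ∧ (W.PosSemidef → ∀ i, 0 ≤ d i) := by
  refine ⟨hW.eigenvectorUnitary, hW.eigenvalues, ?_, ?_, ?_, fun h i => h.eigenvalues_nonneg i⟩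
  · exact Unitary.coe_mul_star_self hW.eigenvectorUnitary
  · exact Unitary.coe_star_mul_self hW.eigenvectorUnitary
  · exact hW.spectral_theorem

open scoped MatrixOrder Matrix.Norms.L2Operator in
lemma exists_eq_mul_conjTranspose {ι : Type*} [Fintype ι] [DecidableEq ι] {W : Matrix ι ι ℂ}
    (hW : W.PosSemidef) : ∃ R : Matrix ι ι ℂ, W = R * Rᴴ :=
  CStarAlgebra.nonneg_iff_eq_mul_star_self.mp hW.nonneg

/-- A Lyapunov kernel element `F W + W F* = 0`, `W ≥ 0`, is a sum of squares of eigenvectors of `F`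
for imaginary eigenvalues. -/
lemma exists_factor_of_lyapunov_eq_zero {F W : Matrix (Fin n) (Fin n) ℂ} (hW : W.PosSemidef)
    (h : F * W + W * Fᴴ = 0) :
    ∃ (Z : Matrix (Fin n) (Fin n) ℂ) (ω : Fin n → ℝ),
      W = Z * Zᴴ ∧ F * Z = Z * diagonal (fun j => Complex.I * (ω j : ℂ)) := by
  obtain ⟨V, d, hV, hV', hWd, hd⟩ := exists_unitary_diagonalization hW.1
  replace hd := hd hW
  set E := diagonal (fun i => (d i : ℂ)) with hE
  set R := diagonal (fun i => (√(d i) : ℂ)) with hRdef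
  have hRR : R * R = E := by
    rw [hRdef, hE, diagonal_mul_diagonal]
    congr 1; ext i
    rw [← Complex.ofReal_mul, Real.mul_self_sqrt (hd i)]
  have hRh : Rᴴ = R := by
    rw [hRdef, diagonal_conjTranspose]; congr 1; ext i; simp
  set G := Vᴴ * F * V with hG
  have hGE : G * E + E * Gᴴ = 0 := by
    have : Vᴴ * (F * W + W * Fᴴ) * V = G * E + E * Gᴴ := by
      rw [hWd, hG]
      simp only [Matrix.mul_add, Matrix.add_mul, conjTranspose_mul, conjTranspose_conjTranspose,
        Matrix.mul_assoc, hV', Matrix.mul_one]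
      rw [← Matrix.mul_assoc Vᴴ V, hV', Matrix.one_mul]
    rw [← this, h]; simp
  have hent : ∀ i j, G i j * (d j : ℂ) + (d i : ℂ) * star (G j i) = 0 := by
    intro i j
    have := congrFun (congrFun hGE i) j
    simpa [hE, Matrix.add_apply, mul_diagonal, diagonal_mul] using this
  -- `S` is `R⁻¹ G R` with `R = E^{1/2}`. When `d i = 0` the convention `0⁻¹ = 0` makes row `i`
  -- zero, and `G R = R S` survives because the equation for `G E` forces `G i j * d j = 0` there.
  -- The Lyapunov equation becomes skew-Hermitianness of `S`, so `S` has an orthonormal eigenbasis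
  -- with imaginary eigenvalues.
  set S : Matrix (Fin n) (Fin n) ℂ :=
    Matrix.of fun i j => ((√(d i))⁻¹ : ℂ) * G i j * (√(d j) : ℂ) with hS
  have hsq : ∀ i, (√(d i) : ℂ) * (√(d i) : ℂ) = d i := by
    intro i; rw [← Complex.ofReal_mul, Real.mul_self_sqrt (hd i)]
  have hzero : ∀ i, √(d i) = 0 → d i = 0 := fun i hi => by
    rwa [Real.sqrt_eq_zero (hd i)] at hi
  have hGR : G * R = R * S := by
    ext i j
    rw [hRdef, mul_diagonal, diagonal_mul, hS, Matrix.of_apply]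
    by_cases hi : √(d i) = 0
    · have := hent i j
      rw [hzero i hi] at this
      simp only [Complex.ofReal_zero, zero_mul, add_zero, mul_eq_zero] at this
      rcases this with h0 | h0
      · simp [h0]
      · have : d j = 0 := by exact_mod_cast h0
        simp [this]
    · have : (√(d i) : ℂ) ≠ 0 := by exact_mod_cast hi
      field_simp
  have hskew : ∀ i j, S i j + star (S j i) = 0 := by
    intro i j
    have := hent i j
    simp only [hS, Matrix.of_apply, star_mul', Complex.star_def, map_inv₀, Complex.conj_ofReal]
      at this ⊢
    by_cases hi : √(d i) = 0
    · simp [hi]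
    by_cases hj : √(d j) = 0
    · simp [hj]
    have hi' : (√(d i) : ℂ) ≠ 0 := by exact_mod_cast hi
    have hj' : (√(d j) : ℂ) ≠ 0 := by exact_mod_cast hj
    rw [← hsq i, ← hsq j] at this
    field_simp
    linear_combination this
  have hHerm : (((-Complex.I) • S)).IsHermitian := by
    ext i j
    have := hskew i j
    simp only [conjTranspose_apply, Matrix.smul_apply, smul_eq_mul, star_mul', star_neg,
      Complex.star_def, Complex.conj_I] at this ⊢
    linear_combination Complex.I * this
  obtain ⟨U, ω, hU, hU', hSd, -⟩ := exists_unitary_diagonalization hHerm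
  have hSU : S * U = U * diagonal (fun j => Complex.I * (ω j : ℂ)) := by
    have h1 : S = Complex.I • ((-Complex.I) • S) := by
      rw [smul_smul]; simp
    have h2 : diagonal (fun j => Complex.I * (ω j : ℂ)) =
        Complex.I • diagonal (fun j => (ω j : ℂ)) := by
      rw [← diagonal_smul]; rfl
    rw [h1, hSd, h2, Matrix.smul_mul, Matrix.mul_assoc, hU', Matrix.mul_one, Matrix.mul_smul]
  refine ⟨V * R * U, ω, ?_, ?_⟩
  · rw [hWd, conjTranspose_mul, conjTranspose_mul, hRh, ← hRR]
    simp only [Matrix.mul_assoc]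
    rw [← Matrix.mul_assoc U, hU, Matrix.one_mul]
  · have hFV : F * V = V * G := by
      rw [hG, Matrix.mul_assoc, ← Matrix.mul_assoc V, hV, Matrix.one_mul]
    calc F * (V * R * U) = V * (G * R) * U := by
          rw [← Matrix.mul_assoc, ← Matrix.mul_assoc, hFV, Matrix.mul_assoc V G R]
      _ = V * R * (S * U) := by rw [hGR]; simp only [Matrix.mul_assoc]
      _ = _ := by rw [hSU]; simp only [Matrix.mul_assoc]

/-- If `ker W₁₁ ⊆ ker W₂₁` and `W₁₁` is Hermitian, then `W₂₁` is a left multiple of `W₁₁`. -/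
lemma exists_mul_eq_of_ker_le {W : Matrix (Fin n) (Fin n) ℂ} (hW : W.IsHermitian)
    {P : Matrix (Fin m) (Fin n) ℂ} (h : ∀ x, W *ᵥ x = 0 → P *ᵥ x = 0) :
    ∃ K : Matrix (Fin m) (Fin n) ℂ, P = K * W := by
  obtain ⟨V, d, hV, hV', hWd, -⟩ := exists_unitary_diagonalization hW
  have hker : ∀ j, d j = 0 → ∀ i, (P * V) i j = 0 := by
    intro j hj i
    have h1 : W *ᵥ (V *ᵥ Pi.single j 1) = 0 := by
      rw [hWd, ← mulVec_mulVec, mulVec_mulVec _ Vᴴ, hV', one_mulVec, ← mulVec_mulVec,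
        diagonal_mulVec_single, hj]
      simp
    have h2 := congrFun (h _ h1) i
    rwa [mulVec_mulVec, mulVec_single_one] at h2
  -- `P` times the pseudo-inverse of `W`; `0⁻¹ = 0` is harmless because `P V` has zero columns where
  -- `d` vanishes.
  refine ⟨P * V * diagonal (fun i => ((d i : ℂ))⁻¹) * Vᴴ, ?_⟩
  have key : P * V * (diagonal (fun i => ((d i : ℂ))⁻¹) * diagonal (fun i => (d i : ℂ))) =
      P * V := by
    rw [diagonal_mul_diagonal]
    ext i j
    rw [mul_diagonal]
    by_cases hj : d j = 0
    · rw [hker j hj i, zero_mul]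
    · have : (d j : ℂ) ≠ 0 := by exact_mod_cast hj
      field_simp
  calc P = P * V * Vᴴ := by rw [Matrix.mul_assoc, hV, Matrix.mul_one]
    _ = P * V * (diagonal (fun i => ((d i : ℂ))⁻¹) * diagonal (fun i => (d i : ℂ))) * Vᴴ := by
        rw [key]
    _ = _ := by
        conv_rhs => rw [hWd]
        simp only [Matrix.mul_assoc]
        rw [← Matrix.mul_assoc Vᴴ V, hV', Matrix.one_mul]

/-- Decomposition of `W ≥ 0` with `A W₁₁ + B W₂₁` skew-Hermitian. -/
lemma exists_decomposition (A : Matrix (Fin n) (Fin n) ℂ) (B : Matrix (Fin n) (Fin m) ℂ)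
    {W : Matrix (Fin n ⊕ Fin m) (Fin n ⊕ Fin m) ℂ} (hW : W.PosSemidef)
    (h : A * W.toBlocks₁₁ + B * W.toBlocks₂₁ + (A * W.toBlocks₁₁ + B * W.toBlocks₂₁)ᴴ = 0) :
    ∃ (Z : Matrix (Fin n) (Fin n) ℂ) (ω : Fin n → ℝ) (K : Matrix (Fin m) (Fin n) ℂ)
      (R : Matrix (Fin m) (Fin m) ℂ),
      W = fromBlocks Z 0 (K * Z) R * (fromBlocks Z 0 (K * Z) R)ᴴ ∧
      A * Z + B * (K * Z) = Z * diagonal (fun j => Complex.I * (ω j : ℂ)) := by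
  have h11 : W.toBlocks₁₁.PosSemidef := hW.submatrix Sum.inl
  have h12 : W.toBlocks₁₂ = W.toBlocks₂₁ᴴ := by
    ext i j
    exact (hW.1.apply (Sum.inl i) (Sum.inr j)).symm
  -- The form of `W` at `(x, 0)` is `x* W₁₁ x`, and a null vector of a semidefinite form lies in the
  -- kernel.
  have hker : ∀ x, W.toBlocks₁₁ *ᵥ x = 0 → W.toBlocks₂₁ *ᵥ x = 0 := by
    intro x hx
    have hWx : W *ᵥ Sum.elim x 0 = Sum.elim (W.toBlocks₁₁ *ᵥ x) (W.toBlocks₂₁ *ᵥ x) := by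
      conv_lhs => rw [← fromBlocks_toBlocks W, fromBlocks_mulVec]
      simp
    have h0 : W *ᵥ Sum.elim x 0 = 0 := by
      rw [← hW.dotProduct_mulVec_zero_iff, hWx, hx]
      simp [dotProduct, Fintype.sum_sum_type]
    rw [h0] at hWx
    ext i
    exact (congrFun hWx (Sum.inr i)).symm
  obtain ⟨K, hK⟩ := exists_mul_eq_of_ker_le h11.1 hker
  have hF : (A + B * K) * W.toBlocks₁₁ + W.toBlocks₁₁ * (A + B * K)ᴴ = 0 := by
    rw [← h, hK]
    simp only [conjTranspose_add, conjTranspose_mul, h11.1.eq, Matrix.add_mul, Matrix.mul_add,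
      Matrix.mul_assoc]
  obtain ⟨Z, ω, hZ, hFZ⟩ := exists_factor_of_lyapunov_eq_zero h11 hF
  -- The Schur complement of a possibly singular `W₁₁`: since `W₂₁ = K W₁₁`, congruence by the row
  -- `(-K, 1)` isolates it.
  have hSchur : (W.toBlocks₂₂ - K * W.toBlocks₁₁ * Kᴴ).PosSemidef := by
    have hc := (hW.mul_mul_conjTranspose_same
      (fromBlocks 0 0 (-K) 1 : Matrix (Fin n ⊕ Fin m) (Fin n ⊕ Fin m) ℂ)).submatrix Sum.inr
    convert hc using 1
    have : fromBlocks 0 0 (-K) 1 * W * (fromBlocks 0 0 (-K) 1)ᴴ =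
        (fromBlocks 0 0 0 (W.toBlocks₂₂ - K * W.toBlocks₁₁ * Kᴴ) :
          Matrix (Fin n ⊕ Fin m) (Fin n ⊕ Fin m) ℂ) := by
      conv_lhs => rw [← fromBlocks_toBlocks W, h12, hK]
      simp only [fromBlocks_conjTranspose, fromBlocks_multiply, conjTranspose_mul, h11.1.eq]
      simp [Matrix.mul_assoc]
      abel
    rw [this]
    ext i j
    simp
  obtain ⟨R, hR⟩ := exists_eq_mul_conjTranspose hSchur
  refine ⟨Z, ω, K, R, ?_, ?_⟩
  · conv_lhs => rw [← fromBlocks_toBlocks W, h12, hK]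
    rw [fromBlocks_conjTranspose, fromBlocks_multiply]
    have hR' : R * Rᴴ = W.toBlocks₂₂ - K * W.toBlocks₁₁ * Kᴴ := hR.symm
    congr 1
    · simp [hZ]
    · simp [hZ, Matrix.mul_assoc, conjTranspose_mul]
    · simp [hZ, Matrix.mul_assoc]
    · rw [hR', hZ, conjTranspose_mul]
      simp [Matrix.mul_assoc]
  · rw [← hFZ, Matrix.add_mul, Matrix.mul_assoc]

/-! ### Separation on the cone of positive semidefinite matrices -/

section compactness

open scoped Matrix.Norms.Elementwise

variable {ι : Type*} [Fintype ι] [DecidableEq ι]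

/-- The set is the image of the Frobenius unit sphere under `Y ↦ Y Yᴴ`. Compactness of this base of
the cone is what permits strict separation. -/
lemma isCompact_posSemidef_trace_eq_one :
    IsCompact {W : Matrix ι ι ℂ | W.PosSemidef ∧ W.trace = 1} := by
  have hK : IsCompact {Y : Matrix ι ι ℂ | (Y * Yᴴ).trace = 1} := by
    refine Metric.isCompact_of_isClosed_isBounded
      (isClosed_eq (by fun_prop) continuous_const) ?_
    refine (Metric.isBounded_closedBall (x := (0 : Matrix ι ι ℂ)) (r := 1)).subset fun Y hY => ?_
    rw [mem_closedBall_zero_iff, Matrix.norm_le_iff zero_le_one]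
    intro i j
    have h1 : ∑ i, ∑ j, ‖Y i j‖ ^ 2 = (1 : ℝ) := by
      have : (Y * Yᴴ).trace = ((∑ i, ∑ j, ‖Y i j‖ ^ 2 : ℝ) : ℂ) := by
        simp only [trace, diag_apply, mul_apply, conjTranspose_apply, Complex.star_def,
          Complex.mul_conj, Complex.normSq_eq_norm_sq]
        push_cast; rfl
      rw [Set.mem_ofPred_eq, this] at hY
      exact_mod_cast hY
    have h2 : ‖Y i j‖ ^ 2 ≤ 1 := by
      rw [← h1]
      refine le_trans ?_ (Finset.single_le_sum (f := fun i => ∑ j, ‖Y i j‖ ^ 2)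
        (fun i _ => Finset.sum_nonneg fun j _ => sq_nonneg _) (Finset.mem_univ i))
      exact Finset.single_le_sum (f := fun j => ‖Y i j‖ ^ 2) (fun j _ => sq_nonneg _)
        (Finset.mem_univ j)
    nlinarith [norm_nonneg (Y i j)]
  convert hK.image (f := fun Y => Y * Yᴴ) (by fun_prop) using 1
  ext W
  constructor
  · rintro ⟨hW, ht⟩
    obtain ⟨R, rfl⟩ := exists_eq_mul_conjTranspose hW
    exact ⟨R, ht, rfl⟩
  · rintro ⟨Y, hY, rfl⟩
    exact ⟨posSemidef_self_mul_conjTranspose Y, hY⟩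

omit [DecidableEq ι] in
lemma convex_posSemidef_trace_eq_one :
    Convex ℝ {W : Matrix ι ι ℂ | W.PosSemidef ∧ W.trace = 1} := by
  rintro W ⟨hW, hWt⟩ W' ⟨hW', hWt'⟩ a b ha hb hab
  refine ⟨(hW.smul ha).add (hW'.smul hb), ?_⟩
  rw [trace_add, trace_smul, trace_smul, hWt, hWt', Complex.real_smul, Complex.real_smul,
    mul_one, mul_one]
  exact_mod_cast hab

/-- A real functional on complex matrices is `X ↦ Re tr (H X)` on Hermitian matrices. -/
lemma exists_hermitian_eq_re_trace (φ : Matrix ι ι ℂ →ₗ[ℝ] ℝ) :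
    ∃ H : Matrix ι ι ℂ, H.IsHermitian ∧
      ∀ X : Matrix ι ι ℂ, X.IsHermitian → φ X = (H * X).trace.re := by
  set a : ι → ι → ℂ := fun i j =>
    ⟨φ (Matrix.single i j 1), -φ (Matrix.single i j Complex.I)⟩ with ha
  set H₀ : Matrix ι ι ℂ := Matrix.of fun j i => a i j with hH₀
  have hφ : ∀ X, φ X = (H₀ * X).trace.re := by
    intro X
    have hX : X = ∑ i, ∑ j, ((X i j).re • Matrix.single i j (1 : ℂ) +
        (X i j).im • Matrix.single i j Complex.I) := by
      conv_lhs => rw [matrix_eq_sum_single X]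
      refine Finset.sum_congr rfl fun i _ => Finset.sum_congr rfl fun j _ => ?_
      rw [smul_single, smul_single, ← single_add]
      congr 1
      apply Complex.ext <;> simp
    conv_lhs => rw [hX]
    simp only [map_sum, map_add, map_smul, smul_eq_mul, trace, diag_apply, mul_apply,
      Complex.re_sum]
    rw [Finset.sum_comm]
    refine Finset.sum_congr rfl fun i _ => Finset.sum_congr rfl fun j _ => ?_
    simp [hH₀, ha]
    ring
  refine ⟨(2⁻¹ : ℝ) • (H₀ + H₀ᴴ), ?_, fun X hX => ?_⟩
  · rw [IsHermitian, conjTranspose_smul, conjTranspose_add, conjTranspose_conjTranspose, add_comm]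
    simp
  · have h : (H₀ᴴ * X).trace = star (H₀ * X).trace := by
      rw [← trace_conjTranspose, conjTranspose_mul, hX.eq, trace_mul_comm]
    rw [hφ, Matrix.smul_mul, Matrix.add_mul, trace_smul, trace_add, h]
    simp
    ring

/-- Alternative theorem: a functional positive on the part of the cone of positive semidefinite
matrices where `T` vanishes dominates a functional of `T`. -/
lemma exists_lt_of_forall_eq_zero {κ : Type*} [Fintype κ] (T : Matrix ι ι ℂ →ₗ[ℝ] Matrix κ κ ℂ)
    (τ : Matrix ι ι ℂ →ₗ[ℝ] ℝ)
    (h : ∀ W : Matrix ι ι ℂ, W.PosSemidef → W.trace = 1 → T W = 0 → 0 < τ W) :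
    ∃ (φ : Matrix κ κ ℂ →ₗ[ℝ] ℝ) (c : ℝ), 0 < c ∧
      ∀ W : Matrix ι ι ℂ, W.PosSemidef → W.trace = 1 → φ (T W) < c * τ W := by
  set S := {W : Matrix (ι) (ι) ℂ | W.PosSemidef ∧ W.trace = 1} with hS
  have hcτ : Continuous τ := τ.continuous_of_finiteDimensional
  set Φ := T.prod τ
  have hcΦ : Continuous Φ := Φ.continuous_of_finiteDimensional
  have hdisj : Disjoint (Φ '' S) (({0} : Set (Matrix (κ) (κ) ℂ)) ×ˢ Set.Iic (0 : ℝ)) := by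
    rw [Set.disjoint_left]
    rintro _ ⟨W, ⟨hW, ht⟩, rfl⟩ ⟨h1, h2⟩
    exact absurd (h W hW ht h1) (not_lt.mpr h2)
  have hlc : LocallyConvexSpace ℝ (Matrix κ κ ℂ) :=
    inferInstanceAs (LocallyConvexSpace ℝ (κ → κ → ℂ))
  obtain ⟨f, a, b, hfa, hab, hfb⟩ := geometric_hahn_banach_compact_closed
    (convex_posSemidef_trace_eq_one.linear_image Φ)
    (isCompact_posSemidef_trace_eq_one.image hcΦ)
    ((convex_singleton 0).prod (convex_Iic 0)) (isClosed_singleton.prod isClosed_Iic) hdisj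
  have hb0 : b < 0 := by
    have := hfb (0, 0) (by simp)
    rwa [Prod.mk_zero_zero, map_zero] at this
  have hfs : ∀ X r, f (X, r) = f (X, 0) + r * f (0, 1) := by
    intro X r
    have : (X, r) = (X, (0 : ℝ)) + r • ((0 : Matrix (κ) (κ) ℂ), (1 : ℝ)) := by
      simp
    rw [this, map_add, map_smul, smul_eq_mul]
  -- The functional is bounded below by `b` on the ray `{0} × (-∞, 0]`, which fixes the sign of its
  -- last coefficient.
  have hc : f (0, 1) ≤ 0 := by
    by_contra! hc
    have := hfb (0, b / f (0, 1)) (by simpa using (div_nonpos_of_nonpos_of_nonneg hb0.le hc.le))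
    rw [hfs, Prod.mk_zero_zero, map_zero, zero_add, div_mul_cancel₀ _ hc.ne'] at this
    exact lt_irrefl _ this
  obtain ⟨r, hr⟩ := isCompact_posSemidef_trace_eq_one.exists_bound_of_continuousOn
    (f := τ) hcτ.continuousOn
  have hr1 : 0 < |r| + 1 := by positivity
  -- The coefficient `-f (0, 1)` may be zero, so the gap `b < 0` is spent on making `c` positive: as
  -- `|τ| ≤ r` on the compact base, `b ≤ -b / (|r| + 1) * τ W`.
  refine ⟨f.toLinearMap.comp (LinearMap.inl ℝ _ ℝ), -f (0, 1) + -b / (|r| + 1), ?_, ?_⟩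
  · have : 0 < -b / (|r| + 1) := div_pos (by linarith) hr1
    linarith
  · intro W hW ht
    have h1 := hfa (Φ W) ⟨W, ⟨hW, ht⟩, rfl⟩
    have h2 := hr W ⟨hW, ht⟩
    have h3 : f (T W, τ W) < a := h1
    rw [hfs] at h3
    change f (T W, 0) < _ * τ W
    have h4 : b ≤ -b / (|r| + 1) * τ W := by
      have h5 : -(|r| + 1) ≤ τ W := by
        have := neg_abs_le (τ W)
        rw [Real.norm_eq_abs] at h2
        linarith [le_abs_self r]
      have h6 : 0 ≤ -b / (|r| + 1) := (div_pos (by linarith) hr1).le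
      have h7 := mul_le_mul_of_nonneg_left h5 h6
      have h8 : -b / (|r| + 1) * -(|r| + 1) = b := by field_simp
      linarith
    nlinarith

end compactness

/-! ### Trace duality and the strict frequency-domain lemma -/

lemma trace_mul_mul_conjTranspose {ι κ : Type*} [Fintype ι] [Fintype κ] (Q : Matrix ι ι ℂ)
    (Y : Matrix ι κ ℂ) :
    (Q * (Y * Yᴴ)).trace = ∑ c, star (Y.col c) ⬝ᵥ Q *ᵥ (Y.col c) := by
  rw [← Matrix.mul_assoc, trace_mul_comm]
  simp only [trace, diag_apply]
  refine Finset.sum_congr rfl fun c _ => ?_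
  rw [Matrix.mul_apply, dotProduct]
  rfl

/-- The constraint operator dual to `H ↦ lyapunovMatrix H`. -/
def lyapDual (A : Matrix (Fin n) (Fin n) ℂ) (B : Matrix (Fin n) (Fin m) ℂ) :
    Matrix (Fin n ⊕ Fin m) (Fin n ⊕ Fin m) ℂ →ₗ[ℝ] Matrix (Fin n) (Fin n) ℂ where
  toFun W := A * W.toBlocks₁₁ + B * W.toBlocks₂₁ + (A * W.toBlocks₁₁ + B * W.toBlocks₂₁)ᴴ
  map_add' W W' := by
    have h1 : (W + W').toBlocks₁₁ = W.toBlocks₁₁ + W'.toBlocks₁₁ := rfl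
    have h2 : (W + W').toBlocks₂₁ = W.toBlocks₂₁ + W'.toBlocks₂₁ := rfl
    rw [h1, h2]
    simp only [Matrix.mul_add, conjTranspose_add]
    abel
  map_smul' r W := by
    have h1 : (r • W).toBlocks₁₁ = r • W.toBlocks₁₁ := rfl
    have h2 : (r • W).toBlocks₂₁ = r • W.toBlocks₂₁ := rfl
    rw [h1, h2]
    simp only [Matrix.mul_smul, conjTranspose_add, conjTranspose_smul, star_trivial, smul_add,
      RingHom.id_apply]

lemma isHermitian_lyapDual (A : Matrix (Fin n) (Fin n) ℂ) (B : Matrix (Fin n) (Fin m) ℂ)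
    (W : Matrix (Fin n ⊕ Fin m) (Fin n ⊕ Fin m) ℂ) : (lyapDual A B W).IsHermitian := by
  change (A * W.toBlocks₁₁ + B * W.toBlocks₂₁ + (A * W.toBlocks₁₁ + B * W.toBlocks₂₁)ᴴ)ᴴ = _
  change _ = A * W.toBlocks₁₁ + B * W.toBlocks₂₁ + (A * W.toBlocks₁₁ + B * W.toBlocks₂₁)ᴴ
  rw [conjTranspose_add, conjTranspose_conjTranspose, add_comm]

lemma trace_mul_lyapDual_vecMulVec (H A : Matrix (Fin n) (Fin n) ℂ) (B : Matrix (Fin n) (Fin m) ℂ)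
    (x : Fin n → ℂ) (u : Fin m → ℂ) :
    (H * lyapDual A B (vecMulVec (Sum.elim x u) (star (Sum.elim x u)))).trace =
      star x ⬝ᵥ H *ᵥ (A *ᵥ x + B *ᵥ u) + star (A *ᵥ x + B *ᵥ u) ⬝ᵥ H *ᵥ x := by
  have h : A * (vecMulVec (Sum.elim x u) (star (Sum.elim x u))).toBlocks₁₁ +
      B * (vecMulVec (Sum.elim x u) (star (Sum.elim x u))).toBlocks₂₁ =
      vecMulVec (A *ᵥ x + B *ᵥ u) (star x) := by
    have h1 : (vecMulVec (Sum.elim x u) (star (Sum.elim x u))).toBlocks₁₁ =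
      vecMulVec x (star x) := rfl
    have h2 : (vecMulVec (Sum.elim x u) (star (Sum.elim x u))).toBlocks₂₁ =
      vecMulVec u (star x) := rfl
    rw [h1, h2, mul_vecMulVec, mul_vecMulVec, add_vecMulVec]
  have h' : lyapDual A B (vecMulVec (Sum.elim x u) (star (Sum.elim x u))) =
      vecMulVec (A *ᵥ x + B *ᵥ u) (star x) + (vecMulVec (A *ᵥ x + B *ᵥ u) (star x))ᴴ := by
    rw [← h]; rfl
  rw [h', conjTranspose_vecMulVec, star_star, Matrix.mul_add, mul_vecMulVec, mul_vecMulVec,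
    trace_add, trace_vecMulVec, trace_vecMulVec, dotProduct_comm, dotProduct_comm (H *ᵥ x)]

/-- Strict Kalman–Yakubovich–Popov lemma. -/
theorem exists_lyapunovMatrix_posDef {A : Matrix (Fin n) (Fin n) ℂ} {B : Matrix (Fin n) (Fin m) ℂ}
    {C : Matrix (Fin m) (Fin n) ℂ} {D : Matrix (Fin m) (Fin m) ℂ}
    (hA : ∀ (ω : ℝ) (x : Fin n → ℂ), A *ᵥ x = (Complex.I * ω) • x → x = 0)
    (hfreq : ∀ (ω : ℝ) (x : Fin n → ℂ) (u : Fin m → ℂ), u ≠ 0 →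
      A *ᵥ x + B *ᵥ u = (Complex.I * ω) • x → 0 < (star u ⬝ᵥ (C *ᵥ x + D *ᵥ u)).re)
    (hD : ∀ u : Fin m → ℂ, u ≠ 0 → 0 < (star u ⬝ᵥ D *ᵥ u).re) :
    ∃ H : Matrix (Fin n) (Fin n) ℂ, H.IsHermitian ∧ (lyapunovMatrix H A B C D).PosDef := by
  set M := lyapunovMatrix 0 A B C D with hM
  have hMq : ∀ x u, star (Sum.elim x u) ⬝ᵥ (M *ᵥ Sum.elim x u) =
      ((2 * (star u ⬝ᵥ (C *ᵥ x + D *ᵥ u)).re : ℝ) : ℂ) := by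
    intro x u
    rw [hM, star_dotProduct_lyapunovMatrix_mulVec, star_dotProduct_add_star_dotProduct]
    simp
  -- dual feasibility
  have hdual : ∀ W : Matrix (Fin n ⊕ Fin m) (Fin n ⊕ Fin m) ℂ, W.PosSemidef → W.trace = 1 →
      lyapDual A B W = 0 → 0 < (M * W).trace.re := by
    intro W hW ht h0
    obtain ⟨Z, ω, K, R, hWY, hZ⟩ := exists_decomposition A B hW h0
    set Y := fromBlocks Z 0 (K * Z) R with hY
    -- A column from the left block is a state-input pair at frequency `ω c`, where `hfreq` applies;
    -- its input cannot vanish, since `hA` would then kill its state. A column from the right block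
    -- has zero state and only sees `D`.
    have hcol : ∀ c, Y.col c ≠ 0 → 0 < (star (Y.col c) ⬝ᵥ M *ᵥ (Y.col c)).re := by
      rintro (c | c) hc
      · have he : Y.col (Sum.inl c) = Sum.elim (Z.col c) ((K * Z).col c) := by
          ext i; cases i <;> rfl
        rw [he] at hc ⊢
        have heq : A *ᵥ Z.col c + B *ᵥ (K * Z).col c = (Complex.I * ω c) • Z.col c := by
          have hc1 : ∀ N : Matrix (Fin n) (Fin n) ℂ, N.col c = N *ᵥ Pi.single c 1 :=
            fun N => (mulVec_single_one N c).symm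
          have hc2 : (K * Z).col c = (K * Z) *ᵥ Pi.single c 1 := (mulVec_single_one _ c).symm
          rw [hc1, hc2, mulVec_mulVec, mulVec_mulVec, ← add_mulVec, hZ, ← mulVec_mulVec,
            diagonal_mulVec_single, mul_one, ← mulVec_smul, ← Pi.single_smul, smul_eq_mul, mul_one]
        rw [hMq, Complex.ofReal_re]
        have hu : (K * Z).col c ≠ 0 := by
          intro hu
          rw [hu, mulVec_zero, add_zero] at heq
          apply hc
          rw [hA _ _ heq, hu]
          ext i; cases i <;> rfl
        linarith [hfreq _ _ _ hu heq]
      · have he : Y.col (Sum.inr c) = Sum.elim (0 : Fin n → ℂ) (R.col c) := by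
          ext i; cases i <;> rfl
        rw [he] at hc ⊢
        have hu : R.col c ≠ 0 := by
          intro hu
          apply hc
          rw [hu]
          ext i; cases i <;> rfl
        rw [hMq, Complex.ofReal_re, mulVec_zero, zero_add]
        linarith [hD _ hu]
    have hcol' : ∀ c, 0 ≤ (star (Y.col c) ⬝ᵥ M *ᵥ (Y.col c)).re := by
      intro c
      by_cases hc : Y.col c = 0
      · simp [hc]
      · exact (hcol c hc).le
    rw [hWY, trace_mul_mul_conjTranspose, Complex.re_sum]
    have hex : ∃ c, Y.col c ≠ 0 := by
      by_contra! hno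
      have : Y = 0 := by
        ext i j
        exact congrFun (hno j) i
      rw [hWY, this] at ht
      simp at ht
    obtain ⟨c, hc⟩ := hex
    exact Finset.sum_pos' (fun c _ => hcol' c) ⟨c, Finset.mem_univ c, hcol c hc⟩
  -- separation
  obtain ⟨φ, c, hc, hpos⟩ : ∃ (φ : Matrix (Fin n) (Fin n) ℂ →ₗ[ℝ] ℝ) (c : ℝ), 0 < c ∧
      ∀ W : Matrix (Fin n ⊕ Fin m) (Fin n ⊕ Fin m) ℂ, W.PosSemidef → W.trace = 1 →
        φ (lyapDual A B W) < c * (M * W).trace.re := by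
    obtain ⟨φ, c, hc, h⟩ := exists_lt_of_forall_eq_zero (lyapDual A B)
      { toFun := fun W => (M * W).trace.re
        map_add' := fun W W' => by rw [Matrix.mul_add, trace_add, Complex.add_re]
        map_smul' := fun r W => by
          rw [Matrix.mul_smul, trace_smul, Complex.smul_re, RingHom.id_apply] } hdual
    exact ⟨φ, c, hc, h⟩
  obtain ⟨H, hH, hφ⟩ := exists_hermitian_eq_re_trace φ
  have hcH : ((c⁻¹ : ℝ) • H).IsHermitian := by
    rw [IsHermitian, conjTranspose_smul, hH.eq, star_trivial]
  -- Testing the separating inequality on `v v*`, normalized to trace one, recovers the quadratic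
  -- form at `v`; dividing by `c` gives `M` coefficient one.
  refine ⟨(c⁻¹ : ℝ) • H, hcH, ?_⟩
  have hQ := lyapunovMatrix_isHermitian hcH A B C D
  refine PosDef.of_dotProduct_mulVec_pos hQ fun w hw => ?_
  have hre : 0 < (star w ⬝ᵥ lyapunovMatrix (c⁻¹ • H) A B C D *ᵥ w).re := by
    rw [← sumElim_comp_inl_inr w] at hw ⊢
    set x := w ∘ Sum.inl
    set u := w ∘ Sum.inr
    set v := Sum.elim x u with hv
    have hN : 0 < star v ⬝ᵥ v := dotProduct_star_self_pos_iff.mpr hw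
    obtain ⟨N, hN'⟩ : ∃ N : ℝ, star v ⬝ᵥ v = N :=
      ⟨_, (Complex.ext rfl (by simpa using (Complex.pos_iff.mp hN).2.symm))⟩
    have hNpos : 0 < N := by rw [hN'] at hN; exact_mod_cast hN
    have hW : (N⁻¹ • vecMulVec v (star v)).PosSemidef :=
      (posSemidef_vecMulVec_self_star v).smul (inv_nonneg.mpr hNpos.le)
    have htr : (N⁻¹ • vecMulVec v (star v)).trace = 1 := by
      rw [trace_smul, trace_vecMulVec, dotProduct_comm, hN', Complex.real_smul, ← Complex.ofReal_mul,
        inv_mul_cancel₀ hNpos.ne', Complex.ofReal_one]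
    have h1 := hpos _ hW htr
    rw [map_smul, map_smul, smul_eq_mul, Matrix.mul_smul, trace_smul, Complex.smul_re,
      smul_eq_mul] at h1
    have h2 : φ (lyapDual A B (vecMulVec v (star v))) <
        c * (M * vecMulVec v (star v)).trace.re := by
      have := mul_lt_mul_of_pos_left h1 hNpos
      field_simp at this
      exact this
    rw [hφ _ (isHermitian_lyapDual A B _), trace_mul_lyapDual_vecMulVec, mul_vecMulVec,
      trace_vecMulVec, dotProduct_comm (M *ᵥ v), hMq, Complex.ofReal_re] at h2
    rw [star_dotProduct_lyapunovMatrix_mulVec, star_dotProduct_add_star_dotProduct,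
      Complex.sub_re, Complex.ofReal_re]
    have h3 : (star x ⬝ᵥ (c⁻¹ • H) *ᵥ (A *ᵥ x + B *ᵥ u) +
        star (A *ᵥ x + B *ᵥ u) ⬝ᵥ (c⁻¹ • H) *ᵥ x).re = c⁻¹ * (star x ⬝ᵥ H *ᵥ (A *ᵥ x + B *ᵥ u) +
        star (A *ᵥ x + B *ᵥ u) ⬝ᵥ H *ᵥ x).re := by
      rw [smul_mulVec, smul_mulVec, dotProduct_smul, dotProduct_smul, ← smul_add,
        Complex.smul_re, smul_eq_mul]
    rw [h3, sub_pos, inv_mul_lt_iff₀ hc]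
    exact h2
  rw [Complex.pos_iff]
  exact ⟨hre, (hQ.im_star_dotProduct_mulVec_self w).symm⟩

/-! ### Lyapunov's theorem -/

lemma exists_mulVec_eq_smul_of_not_isUnit {A : Matrix (Fin n) (Fin n) ℂ} {s : ℂ}
    (h : ¬ IsUnit (s • (1 : Matrix (Fin n) (Fin n) ℂ) - A)) : ∃ x, x ≠ 0 ∧ A *ᵥ x = s • x := by
  rw [isUnit_iff_isUnit_det, isUnit_iff_ne_zero, not_not, ← exists_mulVec_eq_zero_iff] at h
  obtain ⟨x, hx, h⟩ := h
  refine ⟨x, hx, ?_⟩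
  rw [sub_mulVec, smul_mulVec, one_mulVec, sub_eq_zero] at h
  exact h.symm

-- Gelfand's formula: the spectral radius is below some `r < 1`, so `‖T ^ k‖ ≤ r ^ k` for all large
-- `k`.
open scoped Matrix.Norms.L2Operator in
open Filter in
lemma tendsto_pow_zero_of_eigenvalues_norm_lt_one {T : Matrix (Fin n) (Fin n) ℂ}
    (h : ∀ (μ : ℂ) (x : Fin n → ℂ), x ≠ 0 → T *ᵥ x = μ • x → ‖μ‖ < 1) :
    Tendsto (fun k : ℕ => T ^ k) atTop (𝓝 0) := by
  rcases subsingleton_or_nontrivial (Matrix (Fin n) (Fin n) ℂ) with hs | hs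
  · rw [show (fun k : ℕ => T ^ k) = fun _ => 0 from funext fun k => Subsingleton.elim _ _]
    exact tendsto_const_nhds
  have hr : spectralRadius ℂ T < (1 : NNReal) := by
    refine spectrum.spectralRadius_lt_of_forall_lt T fun μ hμ => ?_
    rw [spectrum.mem_iff, Algebra.algebraMap_eq_smul_one] at hμ
    obtain ⟨x, hx, hμx⟩ := exists_mulVec_eq_smul_of_not_isUnit hμ
    exact_mod_cast h μ x hx hμx
  obtain ⟨r, hr0, hr1⟩ := ENNReal.lt_iff_exists_nnreal_btwn.mp hr
  have hr1' : r < 1 := by exact_mod_cast hr1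
  have hev := (spectrum.pow_nnnorm_pow_one_div_tendsto_nhds_spectralRadius T).eventually_lt_const hr0
  rw [tendsto_zero_iff_norm_tendsto_zero]
  refine squeeze_zero' (Eventually.of_forall fun k => norm_nonneg _) ?_
    (tendsto_pow_atTop_nhds_zero_of_lt_one r.2 (by exact_mod_cast hr1'))
  filter_upwards [hev, eventually_gt_atTop 0] with k hk hk0
  have hk0' : (0 : ℝ) < k := by exact_mod_cast hk0
  have h1 : ((‖T ^ k‖₊ : ENNReal) ^ (1 / k : ℝ)) ^ (k : ℝ) ≤ (r : ENNReal) ^ (k : ℝ) :=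
    ENNReal.rpow_le_rpow hk.le hk0'.le
  rw [← ENNReal.rpow_mul, one_div_mul_cancel hk0'.ne', ENNReal.rpow_one, ENNReal.rpow_natCast] at h1
  have h2 : ‖T ^ k‖₊ ≤ r ^ k := by exact_mod_cast h1
  exact_mod_cast h2

/-- Lyapunov's theorem, by way of the Cayley transform. -/
theorem posSemidef_of_lyapunov {H A : Matrix (Fin n) (Fin n) ℂ} (hH : H.IsHermitian)
    (hA : ∀ (l : ℂ) (x : Fin n → ℂ), x ≠ 0 → A *ᵥ x = l • x → l.re < 0)
    (hneg : ∀ x, (star x ⬝ᵥ H *ᵥ (A *ᵥ x) + star (A *ᵥ x) ⬝ᵥ H *ᵥ x).re ≤ 0) :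
    H.PosSemidef := by
  have hU : IsUnit (1 - A) := by
    by_contra hU
    obtain ⟨x, hx, h⟩ := exists_mulVec_eq_smul_of_not_isUnit (A := A) (s := 1) (by rwa [one_smul])
    have := hA 1 x hx h
    norm_num at this
  have hUd : IsUnit (1 - A).det := (isUnit_iff_isUnit_det _).mp hU
  set T := (1 + A) * (1 - A)⁻¹ with hT
  have hTx : ∀ x, T *ᵥ ((1 - A) *ᵥ x) = (1 + A) *ᵥ x := by
    intro x
    rw [mulVec_mulVec, hT, Matrix.mul_assoc, nonsing_inv_mul _ hUd, Matrix.mul_one]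
  have hsurj : ∀ y, ∃ x, (1 - A) *ᵥ x = y := fun y =>
    ⟨(1 - A)⁻¹ *ᵥ y, by rw [mulVec_mulVec, mul_nonsing_inv _ hUd, one_mulVec]⟩
  have hpow : Filter.Tendsto (fun k : ℕ => T ^ k) Filter.atTop (𝓝 0) := by
    refine tendsto_pow_zero_of_eigenvalues_norm_lt_one fun μ y hy hTy => ?_
    obtain ⟨x, rfl⟩ := hsurj y
    have hx : x ≠ 0 := by rintro rfl; simp at hy
    rw [hTx, add_mulVec, sub_mulVec, one_mulVec, smul_sub] at hTy
    have h1 : (1 + μ) • (A *ᵥ x) = (μ - 1) • x := by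
      rw [add_smul, one_smul, sub_smul, one_smul]
      linear_combination (exp := 1) hTy
    by_cases hμ : 1 + μ = 0
    · rw [hμ, zero_smul] at h1
      have h2 : μ - 1 = 0 := by
        by_contra h2
        exact hx ((smul_eq_zero.mp h1.symm).resolve_left h2)
      have : (2 : ℂ) = 0 := by linear_combination hμ - h2
      norm_num at this
    · have h2 : A *ᵥ x = ((μ - 1) / (1 + μ)) • x := by
        rw [div_eq_inv_mul, mul_smul, ← h1, smul_smul, inv_mul_cancel₀ hμ, one_smul]
      have h3 := hA _ x hx h2
      have h4 : ((μ - 1) / (1 + μ)).re * Complex.normSq (1 + μ) = Complex.normSq μ - 1 := by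
        have hn : Complex.normSq (1 + μ) ≠ 0 := by rwa [Ne, Complex.normSq_eq_zero]
        rw [Complex.div_re]
        field_simp
        simp [Complex.normSq_apply]
        ring
      have h5 : 0 < Complex.normSq (1 + μ) := Complex.normSq_pos.mpr hμ
      have h6 : Complex.normSq μ < 1 := by nlinarith
      rw [Complex.normSq_eq_norm_sq] at h6
      nlinarith [norm_nonneg μ]
  -- With `y = (1 - A) x` and `T y = (1 + A) x`, the two forms differ by exactly twice the Lyapunov
  -- expression at `x`. Iterating, the form at `y` dominates its values at `T ^ k y`, which tend to
  -- zero.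
  have hstep : ∀ y, (star (T *ᵥ y) ⬝ᵥ H *ᵥ (T *ᵥ y)).re ≤ (star y ⬝ᵥ H *ᵥ y).re := by
    intro y
    obtain ⟨x, rfl⟩ := hsurj y
    have := hneg x
    rw [hTx]
    simp only [add_mulVec, sub_mulVec, one_mulVec, mulVec_add, mulVec_sub, star_add, star_sub,
      dotProduct_add, dotProduct_sub, add_dotProduct, sub_dotProduct, Complex.add_re,
      Complex.sub_re] at this ⊢
    linarith
  refine PosSemidef.of_dotProduct_mulVec_nonneg hH fun y => ?_
  rw [Complex.nonneg_iff]
  refine ⟨?_, (hH.im_star_dotProduct_mulVec_self y).symm⟩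
  have hle : ∀ k : ℕ, (star ((T ^ k) *ᵥ y) ⬝ᵥ H *ᵥ ((T ^ k) *ᵥ y)).re ≤ (star y ⬝ᵥ H *ᵥ y).re := by
    intro k
    induction k with
    | zero => simp
    | succ k ih =>
      rw [pow_succ', ← mulVec_mulVec]
      exact (hstep _).trans ih
  have hcont : Continuous fun S : Matrix (Fin n) (Fin n) ℂ =>
      (star (S *ᵥ y) ⬝ᵥ H *ᵥ (S *ᵥ y)).re := by fun_prop
  have hlim := (hcont.tendsto 0).comp hpow
  rw [zero_mulVec, mulVec_zero, dotProduct_zero, Complex.zero_re] at hlim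
  exact le_of_tendsto hlim (Filter.Eventually.of_forall hle)

/-! ### Evaluating realizations at points of an extension field -/

section evaluation

variable {L : Type} [Field L] (f : ℂ →+* L) (a : L)

/-- The rational functions without a pole at `a`. -/
def regularSubring : Subring (RatFunc ℂ) where
  carrier := {x | x.denom.eval₂ f a ≠ 0}
  mul_mem' {x y} hx hy h := by
    have := Polynomial.eval₂_eq_zero_of_dvd_of_eval₂_eq_zero f a (RatFunc.denom_mul_dvd x y) h
    rw [Polynomial.eval₂_mul] at this
    exact (mul_ne_zero hx hy) this
  one_mem' := by simp
  add_mem' {x y} hx hy h := by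
    have := Polynomial.eval₂_eq_zero_of_dvd_of_eval₂_eq_zero f a (RatFunc.denom_add_dvd x y) h
    rw [Polynomial.eval₂_mul] at this
    exact (mul_ne_zero hx hy) this
  zero_mem' := by simp
  neg_mem' {x} hx h := by
    have h1 : -x = RatFunc.C (-1) * x := by simp
    rw [h1] at h
    have := Polynomial.eval₂_eq_zero_of_dvd_of_eval₂_eq_zero f a
      (RatFunc.denom_mul_dvd (RatFunc.C (-1)) x) h
    rw [RatFunc.denom_C, one_mul] at this
    exact hx this

lemma mem_regularSubring {x : RatFunc ℂ} : x ∈ regularSubring f a ↔ x.denom.eval₂ f a ≠ 0 :=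
  Iff.rfl

lemma C_mem_regularSubring (c : ℂ) : RatFunc.C c ∈ regularSubring f a := by
  simp [mem_regularSubring]

lemma algebraMap_mem_regularSubring (p : Polynomial ℂ) :
    algebraMap (Polynomial ℂ) (RatFunc ℂ) p ∈ regularSubring f a := by
  simp [mem_regularSubring]

lemma X_mem_regularSubring : RatFunc.X ∈ regularSubring f a := by
  simp [mem_regularSubring]

lemma inv_algebraMap_mem_regularSubring {p : Polynomial ℂ} (hp : p.eval₂ f a ≠ 0) :
    (algebraMap (Polynomial ℂ) (RatFunc ℂ) p)⁻¹ ∈ regularSubring f a := by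
  intro h
  have h1 : (algebraMap (Polynomial ℂ) (RatFunc ℂ) p)⁻¹ =
      algebraMap _ _ (1 : Polynomial ℂ) / algebraMap _ _ p := by simp
  rw [h1] at h
  exact hp (Polynomial.eval₂_eq_zero_of_dvd_of_eval₂_eq_zero f a
    (RatFunc.denom_div_dvd 1 p) h)

/-- Evaluation at `a` as a ring homomorphism. -/
noncomputable def evalHom : regularSubring f a →+* L where
  toFun x := RatFunc.eval f a x
  map_one' := RatFunc.eval_one f a
  map_mul' x y := RatFunc.eval_mul f a x.2 y.2
  map_zero' := RatFunc.eval_zero f a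
  map_add' x y := RatFunc.eval_add f a x.2 y.2

variable {f a}

lemma mul_mem_regularSubring {ι κ ν : Type*} [Fintype κ] {M : Matrix ι κ (RatFunc ℂ)}
    {N : Matrix κ ν (RatFunc ℂ)} (hM : ∀ i j, M i j ∈ regularSubring f a)
    (hN : ∀ i j, N i j ∈ regularSubring f a) (i : ι) (j : ν) :
    (M * N) i j ∈ regularSubring f a := by
  rw [Matrix.mul_apply]
  exact Subring.sum_mem _ fun c _ => Subring.mul_mem _ (hM _ _) (hN _ _)

lemma map_eval_mul {ι κ ν : Type*} [Fintype κ] {M : Matrix ι κ (RatFunc ℂ)}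
    {N : Matrix κ ν (RatFunc ℂ)} (hM : ∀ i j, M i j ∈ regularSubring f a)
    (hN : ∀ i j, N i j ∈ regularSubring f a) :
    (M * N).map (RatFunc.eval f a) = M.map (RatFunc.eval f a) * N.map (RatFunc.eval f a) := by
  ext i j
  have h : (M * N) i j = ((∑ c, (⟨M i c, hM i c⟩ : regularSubring f a) * ⟨N c j, hN c j⟩ :
      regularSubring f a) : RatFunc ℂ) := by
    rw [Matrix.mul_apply]; simp
  rw [map_apply, h]
  change evalHom f a _ = _
  rw [map_sum, Matrix.mul_apply]
  refine Finset.sum_congr rfl fun c _ => ?_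
  rw [map_mul]; rfl

lemma map_eval_add {ι κ : Type*} {M N : Matrix ι κ (RatFunc ℂ)}
    (hM : ∀ i j, M i j ∈ regularSubring f a) (hN : ∀ i j, N i j ∈ regularSubring f a) :
    (M + N).map (RatFunc.eval f a) = M.map (RatFunc.eval f a) + N.map (RatFunc.eval f a) := by
  ext i j
  exact RatFunc.eval_add f a (hM i j) (hN i j)

lemma map_eval_map_C {ι κ : Type*} (M : Matrix ι κ ℂ) :
    (M.map (RatFunc.C : ℂ →+* RatFunc ℂ)).map (RatFunc.eval f a) = M.map f := by
  ext i j; simp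

/-- The matrix pencil `X - A` over the rational functions. -/
noncomputable def pencil (A : Matrix (Fin n) (Fin n) ℂ) : Matrix (Fin n) (Fin n) (RatFunc ℂ) :=
  (RatFunc.X : RatFunc ℂ) • (1 : Matrix (Fin n) (Fin n) (RatFunc ℂ)) -
    A.map (RatFunc.C : ℂ →+* RatFunc ℂ)

lemma pencil_eq_map_charmatrix (A : Matrix (Fin n) (Fin n) ℂ) :
    pencil A = (algebraMap (Polynomial ℂ) (RatFunc ℂ)).mapMatrix A.charmatrix := by
  ext i j
  by_cases h : i = j
  · subst h; simp [pencil]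
  · simp [pencil, h]

lemma det_pencil (A : Matrix (Fin n) (Fin n) ℂ) :
    (pencil A).det = algebraMap (Polynomial ℂ) (RatFunc ℂ) A.charpoly := by
  rw [pencil_eq_map_charmatrix, ← RingHom.map_det]; rfl

lemma isUnit_det_pencil (A : Matrix (Fin n) (Fin n) ℂ) : IsUnit (pencil A).det := by
  rw [det_pencil, isUnit_iff_ne_zero]
  exact RatFunc.algebraMap_ne_zero A.charpoly_monic.ne_zero

lemma pencil_mem_regularSubring (A : Matrix (Fin n) (Fin n) ℂ) (i j : Fin n) :
    pencil A i j ∈ regularSubring f a := by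
  rw [pencil_eq_map_charmatrix]
  exact algebraMap_mem_regularSubring f a _

/-- The inverse is the adjugate, which has polynomial entries, divided by the characteristic
polynomial; poles can only come from the latter. -/
lemma inv_pencil_mem_regularSubring {A : Matrix (Fin n) (Fin n) ℂ}
    (h : A.charpoly.eval₂ f a ≠ 0) (i j : Fin n) :
    (pencil A)⁻¹ i j ∈ regularSubring f a := by
  rw [Matrix.inv_def, det_pencil, Ring.inverse_eq_inv', Matrix.smul_apply, smul_eq_mul,
    pencil_eq_map_charmatrix, ← RingHom.map_adjugate]
  exact Subring.mul_mem _ (inv_algebraMap_mem_regularSubring f a h)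
    (algebraMap_mem_regularSubring f a _)

lemma map_eval_pencil (A : Matrix (Fin n) (Fin n) ℂ) :
    (pencil A).map (RatFunc.eval f a) = a • (1 : Matrix (Fin n) (Fin n) L) - A.map f := by
  rw [pencil_eq_map_charmatrix]
  ext i j
  rw [map_apply, RingHom.mapMatrix_apply, map_apply, RatFunc.eval_algebraMap]
  by_cases h : i = j
  · subst h; simp
  · simp [h]

lemma map_eval_inv_pencil {A : Matrix (Fin n) (Fin n) ℂ} (h : A.charpoly.eval₂ f a ≠ 0) :
    (pencil A)⁻¹.map (RatFunc.eval f a) = (a • (1 : Matrix (Fin n) (Fin n) L) - A.map f)⁻¹ := by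
  refine (Matrix.inv_eq_right_inv ?_).symm
  rw [← map_eval_pencil (f := f) (a := a), ← map_eval_mul (pencil_mem_regularSubring A)
    (inv_pencil_mem_regularSubring h), mul_nonsing_inv _ (isUnit_det_pencil A)]
  ext i j
  by_cases h : i = j
  · subst h; simp
  · simp [h]

variable {F : RatMat m} {A : Matrix (Fin n) (Fin n) ℂ} {B : Matrix (Fin n) (Fin m) ℂ}
  {C : Matrix (Fin m) (Fin n) ℂ} {D : Matrix (Fin m) (Fin m) ℂ}

lemma IsRealization.eq (hR : IsRealization F A B C D) :
    F = C.map (RatFunc.C : ℂ →+* RatFunc ℂ) * (pencil A)⁻¹ * B.map (RatFunc.C : ℂ →+* RatFunc ℂ) +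
      D.map (RatFunc.C : ℂ →+* RatFunc ℂ) := hR

lemma IsRealization.mem_regularSubring (hR : IsRealization F A B C D)
    (h : A.charpoly.eval₂ f a ≠ 0) (i j : Fin m) : F i j ∈ regularSubring f a := by
  rw [hR.eq, Matrix.add_apply]
  exact Subring.add_mem _ (mul_mem_regularSubring (mul_mem_regularSubring
    (fun _ _ => C_mem_regularSubring f a _) (inv_pencil_mem_regularSubring h))
    (fun _ _ => C_mem_regularSubring f a _) i j) (C_mem_regularSubring f a _)

lemma IsRealization.map_eval (hR : IsRealization F A B C D) (h : A.charpoly.eval₂ f a ≠ 0) :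
    F.map (RatFunc.eval f a) =
      C.map f * (a • (1 : Matrix (Fin n) (Fin n) L) - A.map f)⁻¹ * B.map f + D.map f := by
  have hCP := mul_mem_regularSubring (M := C.map (RatFunc.C : ℂ →+* RatFunc ℂ))
    (fun _ _ => C_mem_regularSubring f a _) (inv_pencil_mem_regularSubring (f := f) (a := a) h)
  have hC : ∀ i j, (C.map (RatFunc.C : ℂ →+* RatFunc ℂ)) i j ∈ regularSubring f a :=
    fun _ _ => C_mem_regularSubring f a _
  have hD : ∀ i j, (D.map (RatFunc.C : ℂ →+* RatFunc ℂ)) i j ∈ regularSubring f a :=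
    fun _ _ => C_mem_regularSubring f a _
  have hB : ∀ i j, (B.map (RatFunc.C : ℂ →+* RatFunc ℂ)) i j ∈ regularSubring f a :=
    fun _ _ => C_mem_regularSubring f a _
  conv_lhs => rw [hR.eq]
  rw [map_eval_add (mul_mem_regularSubring hCP hB) hD,
    map_eval_mul hCP hB, map_eval_mul hC
      (inv_pencil_mem_regularSubring h), map_eval_inv_pencil h]
  simp only [map_eval_map_C]

lemma charpoly_eval₂_id_ne_zero {s : ℂ} (h : IsUnit (s • (1 : Matrix (Fin n) (Fin n) ℂ) - A)) :
    A.charpoly.eval₂ (RingHom.id ℂ) s ≠ 0 := by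
  rw [Polynomial.eval₂_id, eval_charpoly]
  rw [isUnit_iff_isUnit_det, isUnit_iff_ne_zero] at h
  convert h using 3
  ext i j
  by_cases hij : i = j
  · subst hij; simp
  · simp [hij]

lemma IsRealization.analyticAtPoint (hR : IsRealization F A B C D) {s : ℂ}
    (h : IsUnit (s • (1 : Matrix (Fin n) (Fin n) ℂ) - A)) : F.AnalyticAtPoint s :=
  hR.mem_regularSubring (charpoly_eval₂_id_ne_zero h)

lemma IsRealization.value_eq (hR : IsRealization F A B C D) {s : ℂ}
    (h : IsUnit (s • (1 : Matrix (Fin n) (Fin n) ℂ) - A)) :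
    F.value s = C * (s • (1 : Matrix (Fin n) (Fin n) ℂ) - A)⁻¹ * B + D := by
  have hid : ∀ {ι κ : Type} (M : Matrix ι κ ℂ), M.map (RingHom.id ℂ) = M := fun M => by ext; rfl
  have := hR.map_eval (charpoly_eval₂_id_ne_zero h)
  rw [hid, hid, hid, hid] at this
  exact this

lemma IsRealization.value_mulVec (hR : IsRealization F A B C D) {s : ℂ}
    (h : IsUnit (s • (1 : Matrix (Fin n) (Fin n) ℂ) - A)) {x : Fin n → ℂ} {u : Fin m → ℂ}
    (hx : A *ᵥ x + B *ᵥ u = s • x) : F.value s *ᵥ u = C *ᵥ x + D *ᵥ u := by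
  have hd : IsUnit (s • (1 : Matrix (Fin n) (Fin n) ℂ) - A).det := (isUnit_iff_isUnit_det _).mp h
  have hB : B *ᵥ u = (s • (1 : Matrix (Fin n) (Fin n) ℂ) - A) *ᵥ x := by
    rw [sub_mulVec, smul_mulVec, one_mulVec, ← hx]; abel
  rw [hR.value_eq h, add_mulVec, ← mulVec_mulVec, hB, mulVec_mulVec, Matrix.mul_assoc,
    nonsing_inv_mul _ hd, Matrix.mul_one]

lemma exists_state (B : Matrix (Fin n) (Fin m) ℂ) {s : ℂ}
    (h : IsUnit (s • (1 : Matrix (Fin n) (Fin n) ℂ) - A)) (u : Fin m → ℂ) :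
    ∃ x, A *ᵥ x + B *ᵥ u = s • x := by
  have hd : IsUnit (s • (1 : Matrix (Fin n) (Fin n) ℂ) - A).det := (isUnit_iff_isUnit_det _).mp h
  refine ⟨(s • (1 : Matrix (Fin n) (Fin n) ℂ) - A)⁻¹ *ᵥ (B *ᵥ u), ?_⟩
  have h1 : (s • (1 : Matrix (Fin n) (Fin n) ℂ) - A) *ᵥ
      ((s • (1 : Matrix (Fin n) (Fin n) ℂ) - A)⁻¹ *ᵥ (B *ᵥ u)) = B *ᵥ u := by
    rw [mulVec_mulVec, mul_nonsing_inv _ hd, one_mulVec]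
  rw [sub_mulVec, smul_mulVec, one_mulVec, sub_eq_iff_eq_add] at h1
  rw [h1, add_comm]

-- The resolvent tends to zero at infinity, and the formula for `F.value` holds off the bounded
-- spectrum of `A`.
open scoped Matrix.Norms.L2Operator in
open Filter in
lemma IsRealization.tendsto_value (hR : IsRealization F A B C D) :
    Tendsto F.value (Bornology.cobounded ℂ) (𝓝 D) := by
  have h1 := spectrum.resolvent_tendsto_cobounded (𝕜 := ℂ) A
  have h2 : Tendsto (fun s => C * resolvent A s * B + D) (Bornology.cobounded ℂ) (𝓝 D) := by
    have hc : Continuous fun N : Matrix (Fin n) (Fin n) ℂ => C * N * B + D := by fun_prop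
    have := (hc.tendsto 0).comp h1
    rw [Matrix.mul_zero, Matrix.zero_mul, zero_add] at this
    exact this
  refine h2.congr' ?_
  have hb : ∀ᶠ s : ℂ in Bornology.cobounded ℂ, s ∉ spectrum ℂ A :=
    spectrum.isBounded (𝕜 := ℂ) A
  filter_upwards [hb] with s hs
  have hu : IsUnit (s • (1 : Matrix (Fin n) (Fin n) ℂ) - A) := by
    rwa [spectrum.notMem_iff, Algebra.algebraMap_eq_smul_one] at hs
  rw [hR.value_eq hu, resolvent, Algebra.algebraMap_eq_smul_one, nonsing_inv_eq_ringInverse]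

end evaluation

lemma eval₂_X_sub_C_ne_zero {p : Polynomial ℂ} (hp : p ≠ 0) (c : ℂ) :
    p.eval₂ (RatFunc.C : ℂ →+* RatFunc ℂ) (RatFunc.X - RatFunc.C c) ≠ 0 := by
  have h : p.eval₂ (RatFunc.C : ℂ →+* RatFunc ℂ) (RatFunc.X - RatFunc.C c) =
      algebraMap (Polynomial ℂ) (RatFunc ℂ) (p.comp (Polynomial.X - Polynomial.C c)) := by
    rw [Polynomial.comp, Polynomial.hom_eval₂, RatFunc.algebraMap_comp_C]
    simp
  rw [h]
  refine RatFunc.algebraMap_ne_zero fun h0 => hp ?_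
  have := congrArg (fun q : Polynomial ℂ => q.comp (Polynomial.X + Polynomial.C c)) h0
  simpa [Polynomial.comp_assoc] using this

/-- Shifting is evaluation at the point `X - ε` of the field `RatFunc ℂ`, where no nonzero
polynomial vanishes. Hence `map_eval` applies with that field as target, and `(X - ε) - A = X - (A +
ε)`. -/
lemma IsRealization.shift {F : RatMat m} {A : Matrix (Fin n) (Fin n) ℂ}
    {B : Matrix (Fin n) (Fin m) ℂ} {C : Matrix (Fin m) (Fin n) ℂ} {D : Matrix (Fin m) (Fin m) ℂ}
    (hR : IsRealization F A B C D) (ε : ℝ) :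
    IsRealization (F.shift ε) (A + (ε : ℂ) • (1 : Matrix (Fin n) (Fin n) ℂ)) B C D := by
  have h := hR.map_eval (eval₂_X_sub_C_ne_zero A.charpoly_monic.ne_zero (ε : ℂ))
  rw [IsRealization, RatMat.shift, h]
  congr 4
  ext i j
  by_cases hij : i = j
  · subst hij; simp; ring
  · simp [hij]

/-! ### Minimality, controllability and observability -/

/-- Controllability: no proper `A`-invariant subspace contains the range of `B`. -/
def IsControllable (A : Matrix (Fin n) (Fin n) ℂ) (B : Matrix (Fin n) (Fin m) ℂ) : Prop :=
  ∀ V : Submodule ℂ (Fin n → ℂ), (∀ u, B *ᵥ u ∈ V) → (∀ v ∈ V, A *ᵥ v ∈ V) → V = ⊤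

/-- Observability: no nonzero `A`-invariant subspace lies in the kernel of `C`. -/
def IsObservable (A : Matrix (Fin n) (Fin n) ℂ) (C : Matrix (Fin m) (Fin n) ℂ) : Prop :=
  ∀ V : Submodule ℂ (Fin n → ℂ), (∀ v ∈ V, C *ᵥ v = 0) → (∀ v ∈ V, A *ᵥ v ∈ V) → V = ⊥

variable {F : RatMat m} {A : Matrix (Fin n) (Fin n) ℂ} {B : Matrix (Fin n) (Fin m) ℂ}
  {C : Matrix (Fin m) (Fin n) ℂ} {D : Matrix (Fin m) (Fin m) ℂ}

lemma add_smul_one_mulVec_mem_iff {V : Submodule ℂ (Fin n → ℂ)} (c : ℂ) {v : Fin n → ℂ}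
    (hv : v ∈ V) : (A + c • (1 : Matrix (Fin n) (Fin n) ℂ)) *ᵥ v ∈ V ↔ A *ᵥ v ∈ V := by
  rw [add_mulVec, smul_mulVec, one_mulVec]
  exact V.add_mem_iff_left (V.smul_mem c hv)

lemma IsControllable.add_smul_one (h : IsControllable A B) (c : ℂ) :
    IsControllable (A + c • (1 : Matrix (Fin n) (Fin n) ℂ)) B := fun V hB hA =>
  h V hB fun v hv => (add_smul_one_mulVec_mem_iff c hv).mp (hA v hv)

lemma IsObservable.add_smul_one (h : IsObservable A C) (c : ℂ) :
    IsObservable (A + c • (1 : Matrix (Fin n) (Fin n) ℂ)) C := fun V hC hA =>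
  h V hC fun v hv => (add_smul_one_mulVec_mem_iff c hv).mp (hA v hv)

lemma inv_pencil_mul_of_intertwine {A' : Matrix (Fin k) (Fin k) ℂ} {E : Matrix (Fin n) (Fin k) ℂ}
    (h : A * E = E * A') :
    (pencil A)⁻¹ * E.map (RatFunc.C : ℂ →+* RatFunc ℂ) =
      E.map (RatFunc.C : ℂ →+* RatFunc ℂ) * (pencil A')⁻¹ := by
  have h1 : pencil A * E.map (RatFunc.C : ℂ →+* RatFunc ℂ) =
      E.map (RatFunc.C : ℂ →+* RatFunc ℂ) * pencil A' := by
    rw [pencil, pencil, Matrix.sub_mul, Matrix.mul_sub, ← Matrix.map_mul, ← Matrix.map_mul, h]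
    simp
  calc (pencil A)⁻¹ * E.map (RatFunc.C : ℂ →+* RatFunc ℂ)
      = (pencil A)⁻¹ * (E.map (RatFunc.C : ℂ →+* RatFunc ℂ) * pencil A') * (pencil A')⁻¹ := by
        rw [Matrix.mul_assoc, Matrix.mul_assoc, mul_nonsing_inv _ (isUnit_det_pencil A'),
          Matrix.mul_one]
    _ = _ := by
        rw [← h1, ← Matrix.mul_assoc, nonsing_inv_mul _ (isUnit_det_pencil A), Matrix.one_mul]

lemma mcMillanDegree_le (hR : IsRealization F A B C D) : mcMillanDegree F ≤ n :=
  Nat.sInf_le ⟨A, B, C, D, hR⟩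

lemma IsRealization.of_controlled {A' : Matrix (Fin k) (Fin k) ℂ} {B' : Matrix (Fin k) (Fin m) ℂ}
    {E : Matrix (Fin n) (Fin k) ℂ} (hR : IsRealization F A B C D) (hA : A * E = E * A')
    (hB : B = E * B') : IsRealization F A' B' (C * E) D := by
  have h := hR.eq
  rw [hB, Matrix.map_mul, ← Matrix.mul_assoc, Matrix.mul_assoc _ (pencil A)⁻¹,
    inv_pencil_mul_of_intertwine hA, ← Matrix.mul_assoc, ← Matrix.map_mul] at h
  exact h

lemma IsRealization.of_observed {A' : Matrix (Fin k) (Fin k) ℂ} {C' : Matrix (Fin m) (Fin k) ℂ}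
    {E : Matrix (Fin k) (Fin n) ℂ} (hR : IsRealization F A B C D) (hA : A' * E = E * A)
    (hC : C = C' * E) : IsRealization F A' (E * B) C' D := by
  have h := hR.eq
  rw [hC, Matrix.map_mul, Matrix.mul_assoc (C'.map _), ← inv_pencil_mul_of_intertwine hA,
    ← Matrix.mul_assoc, Matrix.mul_assoc _ (E.map _), ← Matrix.map_mul] at h
  exact h

lemma toMatrix_basisFun_mulVecLin (N : Matrix (Fin n) (Fin m) ℂ) :
    LinearMap.toMatrix (Pi.basisFun ℂ (Fin m)) (Pi.basisFun ℂ (Fin n)) N.mulVecLin = N := by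
  ext i j; simp [LinearMap.toMatrix_apply]

/-- Restricting the state space to a proper invariant subspace containing the range of `B` would
still realize `F`, in smaller dimension. -/
theorem IsRealization.isControllable (hR : IsRealization F A B C D) (hn : n = mcMillanDegree F) :
    IsControllable A B := by
  intro V hB hA
  by_contra hV
  have hlt : Module.finrank ℂ V < n := by
    simpa using Submodule.finrank_lt hV
  let b := Module.finBasis ℂ V
  let e := Pi.basisFun ℂ (Fin n)
  let A' := LinearMap.toMatrix b b (A.mulVecLin.restrict hA)
  let B' := LinearMap.toMatrix (Pi.basisFun ℂ (Fin m)) b (B.mulVecLin.codRestrict V hB)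
  let E := LinearMap.toMatrix b e V.subtype
  have h1 : A * E = E * A' := by
    have hA1 : A = LinearMap.toMatrix e e A.mulVecLin := (toMatrix_basisFun_mulVecLin A).symm
    rw [hA1, ← LinearMap.toMatrix_comp, ← LinearMap.toMatrix_comp]
    rfl
  have h2 : B = E * B' := by
    have hB1 : B = LinearMap.toMatrix (Pi.basisFun ℂ (Fin m)) e B.mulVecLin :=
      (toMatrix_basisFun_mulVecLin B).symm
    rw [hB1, ← LinearMap.toMatrix_comp]
    rfl
  have := mcMillanDegree_le (hR.of_controlled h1 h2)
  omega

/-- Dually, a nonzero invariant subspace inside the kernel of `C` could be divided out without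
changing `F`. -/
theorem IsRealization.isObservable (hR : IsRealization F A B C D) (hn : n = mcMillanDegree F) :
    IsObservable A C := by
  intro V hC hA
  by_contra hV
  have hlt : Module.finrank ℂ ((Fin n → ℂ) ⧸ V) < n := by
    have h1 := V.finrank_quotient_add_finrank
    have h2 : 0 < Module.finrank ℂ V := by
      rw [Module.finrank_pos_iff]
      exact Submodule.nontrivial_iff_ne_bot.mpr hV
    simp only [Module.finrank_fin_fun] at h1
    omega
  let b := Module.finBasis ℂ ((Fin n → ℂ) ⧸ V)
  let e := Pi.basisFun ℂ (Fin n)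
  let A' := LinearMap.toMatrix b b (V.mapQ V A.mulVecLin hA)
  let C' := LinearMap.toMatrix b (Pi.basisFun ℂ (Fin m)) (V.liftQ C.mulVecLin hC)
  let E := LinearMap.toMatrix e b V.mkQ
  have h1 : A' * E = E * A := by
    have hA1 : A = LinearMap.toMatrix e e A.mulVecLin := (toMatrix_basisFun_mulVecLin A).symm
    conv_rhs => rw [hA1]
    rw [← LinearMap.toMatrix_comp, ← LinearMap.toMatrix_comp]
    rfl
  have h2 : C = C' * E := by
    have hC1 : C = LinearMap.toMatrix e (Pi.basisFun ℂ (Fin m)) C.mulVecLin :=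
      (toMatrix_basisFun_mulVecLin C).symm
    rw [hC1, ← LinearMap.toMatrix_comp]
    rfl
  have := mcMillanDegree_le (hR.of_observed h1 h2)
  omega

/-- For a controllable and observable realization, the eigenvalues of `A` are poles of `F`. -/
theorem IsRealization.not_analyticAtPoint (hR : IsRealization F A B C D)
    (hcon : IsControllable A B) (hobs : IsObservable A C) {l : ℂ} {x : Fin n → ℂ} (hx : x ≠ 0)
    (hl : A *ᵥ x = l • x) : ¬ F.AnalyticAtPoint l := by
  intro hF
  set R := regularSubring (RingHom.id ℂ) l
  set c : ℂ →+* RatFunc ℂ := RatFunc.C with hc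
  set G := C.map c * (pencil A)⁻¹ with hG
  have hcomp : ∀ {p q : ℕ} (N : Matrix (Fin p) (Fin q) ℂ) (v : Fin q → ℂ),
      N.map c *ᵥ (c ∘ v) = c ∘ (N *ᵥ v) := fun N v =>
    funext fun i => (RingHom.map_mulVec c N v i).symm
  have hCR : ∀ z : ℂ, c z ∈ R := C_mem_regularSubring _ _
  have hXR : RatFunc.X ∈ R := X_mem_regularSubring _ _
  -- `V` consists of the `v` for which `C (X - A)⁻¹ v` has no pole at `l`. It contains the range of
  -- `B` because `G B u = F u - D u`, and it is `A`-invariant because `G A v = X G v - C v`;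
  -- controllability makes it everything.
  let V : Submodule ℂ (Fin n → ℂ) :=
    { carrier := {v | ∀ i, (G *ᵥ (c ∘ v)) i ∈ R}
      zero_mem' := fun i => by
        have : c ∘ (0 : Fin n → ℂ) = 0 := by ext; simp
        rw [this, mulVec_zero]
        exact R.zero_mem
      add_mem' := fun {v w} hv hw i => by
        have : c ∘ (v + w) = c ∘ v + c ∘ w := by ext; simp
        rw [this, mulVec_add]
        exact R.add_mem (hv i) (hw i)
      smul_mem' := fun z v hv i => by
        have : c ∘ (z • v) = c z • (c ∘ v) := by ext; simp
        rw [this, mulVec_smul]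
        exact R.mul_mem (hCR z) (hv i) }
  have hpencil : ∀ v : Fin n → ℂ, pencil A *ᵥ (c ∘ v) = (RatFunc.X : RatFunc ℂ) • (c ∘ v) - c ∘ (A *ᵥ v) := by
    intro v
    rw [pencil, sub_mulVec, smul_mulVec, one_mulVec, hcomp]
  have hGp : ∀ v, G *ᵥ (pencil A *ᵥ (c ∘ v)) = c ∘ (C *ᵥ v) := by
    intro v
    rw [mulVec_mulVec, hG, Matrix.mul_assoc, nonsing_inv_mul _ (isUnit_det_pencil A),
      Matrix.mul_one, hcomp]
  have hV : V = ⊤ := by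
    refine hcon V (fun u i => ?_) (fun v hv i => ?_)
    · have h1 : G *ᵥ (c ∘ (B *ᵥ u)) = F *ᵥ (c ∘ u) - c ∘ (D *ᵥ u) := by
        have hRF : F = G * B.map c + D.map c := hR.eq
        rw [hRF, add_mulVec, hcomp D, add_sub_cancel_right, ← hcomp B, mulVec_mulVec]
      rw [h1]
      refine R.sub_mem ?_ (hCR _)
      change ∑ j, F i j * c (u j) ∈ R
      exact R.sum_mem fun j _ => R.mul_mem (hF i j) (hCR _)
    · have h1 : G *ᵥ (c ∘ (A *ᵥ v)) = (RatFunc.X : RatFunc ℂ) • (G *ᵥ (c ∘ v)) - c ∘ (C *ᵥ v) := by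
        rw [← hGp, hpencil, mulVec_sub, mulVec_smul]
        abel
      rw [h1]
      exact R.sub_mem (R.mul_mem hXR (hv i)) (hCR _)
  have hxV : x ∈ V := hV ▸ Submodule.mem_top
  -- Since `(X - l) G x = C x` and `G x` is regular at `l`, evaluation at `l` gives zero; then the
  -- line through `x` contradicts observability.
  have hCx : C *ᵥ x = 0 := by
    have h1 : ((RatFunc.X : RatFunc ℂ) - c l) • (G *ᵥ (c ∘ x)) = c ∘ (C *ᵥ x) := by
      have h2 : c ∘ (A *ᵥ x) = c l • (c ∘ x) := by rw [hl]; ext; simp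
      rw [← hGp, hpencil, h2, ← sub_smul, mulVec_smul]
    ext i
    have h3 := congrArg (RatFunc.eval (RingHom.id ℂ) l) (congrFun h1 i)
    rw [Pi.smul_apply, smul_eq_mul, RatFunc.eval_mul _ _ (R.sub_mem hXR (hCR l)) (hxV i),
      sub_eq_add_neg, RatFunc.eval_add _ _ hXR (R.neg_mem (hCR l)), ← map_neg,
      Function.comp_apply, hc, RatFunc.eval_C, RatFunc.eval_C, RatFunc.eval_X] at h3
    simpa using h3.symm
  have hspan : Submodule.span ℂ {x} = ⊥ := by
    refine hobs _ (fun v hv => ?_) (fun v hv => ?_)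
    · obtain ⟨z, rfl⟩ := Submodule.mem_span_singleton.mp hv
      rw [mulVec_smul, hCx, smul_zero]
    · obtain ⟨z, rfl⟩ := Submodule.mem_span_singleton.mp hv
      rw [mulVec_smul, hl]
      exact Submodule.smul_mem _ _ (Submodule.smul_mem _ _ (Submodule.mem_span_singleton_self x))
  exact hx (Submodule.span_singleton_eq_bot.mp hspan)

/-! ### Sufficiency of the matrix inequalities -/

lemma mem_lyapClosed_iff {M : Matrix (Fin m) (Fin m) ℂ} :
    M ∈ lyapClosed m ↔ ∀ u : Fin m → ℂ, 0 ≤ (star u ⬝ᵥ M *ᵥ u).re := by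
  have hq : ∀ u : Fin m → ℂ, star u ⬝ᵥ ((M + Mᴴ) *ᵥ u) = ((2 * (star u ⬝ᵥ M *ᵥ u).re : ℝ) : ℂ) :=
    fun u => by rw [star_dotProduct_add_conjTranspose_mulVec, star_dotProduct_add_star_dotProduct]
  constructor
  · intro h u
    have := h.dotProduct_mulVec_nonneg u
    rw [hq, Complex.zero_le_real] at this
    linarith
  · intro h
    refine PosSemidef.of_dotProduct_mulVec_nonneg (isHermitian_add_conjTranspose M) fun u => ?_
    rw [hq, Complex.zero_le_real]
    linarith [h u]

lemma mem_lyapOpen_iff {M : Matrix (Fin m) (Fin m) ℂ} :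
    M ∈ lyapOpen m ↔ ∀ u : Fin m → ℂ, u ≠ 0 → 0 < (star u ⬝ᵥ M *ᵥ u).re := by
  have hq : ∀ u : Fin m → ℂ, star u ⬝ᵥ ((M + Mᴴ) *ᵥ u) = ((2 * (star u ⬝ᵥ M *ᵥ u).re : ℝ) : ℂ) :=
    fun u => by rw [star_dotProduct_add_conjTranspose_mulVec, star_dotProduct_add_star_dotProduct]
  constructor
  · intro h u hu
    have := h.dotProduct_mulVec_pos hu
    rw [hq, Complex.zero_lt_real] at this
    linarith
  · intro h
    refine PosDef.of_dotProduct_mulVec_pos (isHermitian_add_conjTranspose M) fun u hu => ?_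
    rw [hq, Complex.zero_lt_real]
    linarith [h u hu]

lemma re_lyapunovMatrix_of_eq_smul (H A : Matrix (Fin n) (Fin n) ℂ)
    (B : Matrix (Fin n) (Fin m) ℂ) (C : Matrix (Fin m) (Fin n) ℂ) (D : Matrix (Fin m) (Fin m) ℂ)
    {x : Fin n → ℂ} {u : Fin m → ℂ} {s : ℂ} (h : A *ᵥ x + B *ᵥ u = s • x) :
    (star (Sum.elim x u) ⬝ᵥ (lyapunovMatrix H A B C D *ᵥ Sum.elim x u)).re =
      2 * (star u ⬝ᵥ (C *ᵥ x + D *ᵥ u)).re - 2 * s.re * (star x ⬝ᵥ H *ᵥ x).re := by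
  rw [star_dotProduct_lyapunovMatrix_mulVec_of_eq_smul H A B C D h,
    star_dotProduct_add_star_dotProduct, Complex.sub_re, Complex.ofReal_re]
  congr 1
  have : (2 * (s.re : ℂ)) = ((2 * s.re : ℝ) : ℂ) := by push_cast; rfl
  rw [this, Complex.re_ofReal_mul]

lemma re_lyapunovMatrix_zero_right (H A : Matrix (Fin n) (Fin n) ℂ)
    (B : Matrix (Fin n) (Fin m) ℂ) (C : Matrix (Fin m) (Fin n) ℂ) (D : Matrix (Fin m) (Fin m) ℂ)
    (x : Fin n → ℂ) :
    (star (Sum.elim x 0) ⬝ᵥ (lyapunovMatrix H A B C D *ᵥ Sum.elim x 0)).re =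
      -(star x ⬝ᵥ H *ᵥ (A *ᵥ x) + star (A *ᵥ x) ⬝ᵥ H *ᵥ x).re := by
  rw [star_dotProduct_lyapunovMatrix_mulVec]
  simp

lemma sumElim_ne_zero {x : Fin n → ℂ} {u : Fin m → ℂ} (h : x ≠ 0 ∨ u ≠ 0) :
    Sum.elim x u ≠ 0 := by
  intro h0
  rcases h with h | h
  · exact h (funext fun i => congrFun h0 (Sum.inl i))
  · exact h (funext fun i => congrFun h0 (Sum.inr i))

lemma re_dotProduct_pos {ι : Type*} [Fintype ι] {M : Matrix ι ι ℂ} (hM : M.PosDef) {x : ι → ℂ}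
    (hx : x ≠ 0) : 0 < (star x ⬝ᵥ M *ᵥ x).re :=
  (Complex.pos_iff.mp (hM.dotProduct_mulVec_pos hx)).1

lemma re_dotProduct_nonneg {ι : Type*} [Fintype ι] {M : Matrix ι ι ℂ} (hM : M.PosSemidef)
    (x : ι → ℂ) : 0 ≤ (star x ⬝ᵥ M *ᵥ x).re :=
  (Complex.nonneg_iff.mp (hM.dotProduct_mulVec_nonneg x)).1

variable {F : RatMat m} {H A : Matrix (Fin n) (Fin n) ℂ} {B : Matrix (Fin n) (Fin m) ℂ}
  {C : Matrix (Fin m) (Fin n) ℂ} {D : Matrix (Fin m) (Fin m) ℂ}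

lemma isUnit_of_forall_eigenvalue {s : ℂ} (h : ∀ x : Fin n → ℂ, x ≠ 0 → A *ᵥ x ≠ s • x) :
    IsUnit (s • (1 : Matrix (Fin n) (Fin n) ℂ) - A) := by
  by_contra hU
  obtain ⟨x, hx, hs⟩ := exists_mulVec_eq_smul_of_not_isUnit hU
  exact h x hx hs

theorem isPositiveReal_of_posSemidef (hR : IsRealization F A B C D) (hH : H.PosDef)
    (hQ : (lyapunovMatrix H A B C D).PosSemidef) : IsPositiveReal F := by
  intro s hs
  have hU : IsUnit (s • (1 : Matrix (Fin n) (Fin n) ℂ) - A) := by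
    refine isUnit_of_forall_eigenvalue fun x hx h => ?_
    have h1 := re_lyapunovMatrix_of_eq_smul H A B C D (u := 0) (by simpa using h)
    have h2 := re_dotProduct_nonneg hQ (Sum.elim x 0)
    have h3 := mul_pos hs (re_dotProduct_pos hH hx)
    simp only [star_zero, zero_dotProduct, Complex.zero_re] at h1
    linarith
  refine ⟨hR.analyticAtPoint hU, mem_lyapClosed_iff.mpr fun u => ?_⟩
  obtain ⟨x, hx⟩ := exists_state B hU u
  rw [hR.value_mulVec hU hx]
  have h1 := re_lyapunovMatrix_of_eq_smul H A B C D hx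
  have h2 := re_dotProduct_nonneg hQ (Sum.elim x u)
  have h3 := mul_nonneg hs.le (re_dotProduct_nonneg hH.posSemidef x)
  linarith

/-- Strictness now comes from the form rather than from `Re s`, so the imaginary axis is included.
The point at infinity corresponds to zero state, where the form reduces to that of `D + D*`. -/
theorem isHyperPositiveReal_of_posDef (hR : IsRealization F A B C D) (hH : H.PosDef)
    (hQ : (lyapunovMatrix H A B C D).PosDef) : IsHyperPositiveReal F := by
  refine ⟨fun s hs => ?_, D, mem_lyapOpen_iff.mpr fun u hu => ?_, hR.tendsto_value⟩
  · have hU : IsUnit (s • (1 : Matrix (Fin n) (Fin n) ℂ) - A) := by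
      refine isUnit_of_forall_eigenvalue fun x hx h => ?_
      have h1 := re_lyapunovMatrix_of_eq_smul H A B C D (u := 0) (by simpa using h)
      have h2 := re_dotProduct_pos hQ (sumElim_ne_zero (u := (0 : Fin m → ℂ)) (Or.inl hx))
      have h3 := mul_nonneg hs (re_dotProduct_pos hH hx).le
      simp only [star_zero, zero_dotProduct, Complex.zero_re] at h1
      linarith
    refine ⟨hR.analyticAtPoint hU, mem_lyapOpen_iff.mpr fun u hu => ?_⟩
    obtain ⟨x, hx⟩ := exists_state B hU u
    rw [hR.value_mulVec hU hx]
    have h1 := re_lyapunovMatrix_of_eq_smul H A B C D hx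
    have h2 := re_dotProduct_pos hQ (sumElim_ne_zero (x := x) (Or.inr hu))
    have h3 := mul_nonneg hs (re_dotProduct_nonneg hH.posSemidef x)
    linarith
  · have h1 := re_dotProduct_pos hQ (sumElim_ne_zero (x := (0 : Fin n → ℂ)) (Or.inr hu))
    rw [star_dotProduct_lyapunovMatrix_mulVec, star_dotProduct_add_star_dotProduct] at h1
    simp at h1
    exact h1

lemma exists_pos_posSemidef_sub_smul {Δ : Matrix (Fin n) (Fin n) ℂ} (hΔ : Δ.PosDef)
    (hH : H.IsHermitian) : ∃ ε : ℝ, 0 < ε ∧ (Δ - (ε : ℂ) • H).PosSemidef := by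
  obtain ⟨Y, hY⟩ := exists_eq_mul_conjTranspose hΔ.posSemidef
  have hYu : IsUnit Y.det := by
    have := (isUnit_iff_isUnit_det _).mp hΔ.isUnit
    rw [hY, det_mul] at this
    exact isUnit_of_mul_isUnit_left this
  have hYu' : IsUnit Yᴴ.det := by rw [det_conjTranspose]; exact hYu.star
  set N := Y⁻¹ * H * (Y⁻¹)ᴴ with hN
  have hNH : N.IsHermitian := isHermitian_mul_mul_conjTranspose _ hH
  have hHN : H = Y * N * Yᴴ := by
    rw [hN, conjTranspose_nonsing_inv]
    simp only [Matrix.mul_assoc]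
    rw [nonsing_inv_mul _ hYu', Matrix.mul_one, mul_nonsing_inv_cancel_left _ _ hYu]
  obtain ⟨V, d, hV, hV', hNd, -⟩ := exists_unitary_diagonalization hNH
  have hpos : 0 < 1 + ∑ i, |d i| := by positivity
  -- After congruence by `Y`, `Δ` becomes the identity and `H` has eigenvalues `d i`, so only `ε * d
  -- i ≤ 1` is needed; the summand `1` covers the case where all `d i` vanish.
  refine ⟨(1 + ∑ i, |d i|)⁻¹, inv_pos.mpr hpos, ?_⟩
  set ε := (1 + ∑ i, |d i|)⁻¹ with hε
  have h1 : Δ - (ε : ℂ) • H =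
      (Y * V) * diagonal (fun i => ((1 - ε * d i : ℝ) : ℂ)) * (Y * V)ᴴ := by
    have h2 : diagonal (fun i => ((1 - ε * d i : ℝ) : ℂ)) =
        1 - (ε : ℂ) • diagonal (fun i => (d i : ℂ)) := by
      ext i j
      by_cases hij : i = j
      · subst hij; simp
      · simp [hij]
    have h3 : Y * V * (Y * V)ᴴ = Δ := by
      rw [conjTranspose_mul, Matrix.mul_assoc, ← Matrix.mul_assoc V, hV, Matrix.one_mul, hY]
    have h4 : Y * V * diagonal (fun i => (d i : ℂ)) * (Y * V)ᴴ = H := by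
      rw [hHN, hNd, conjTranspose_mul]; simp only [Matrix.mul_assoc]
    rw [h2, Matrix.mul_sub, Matrix.sub_mul, Matrix.mul_one, h3, Matrix.mul_smul, Matrix.smul_mul, h4]
  rw [h1]
  refine PosSemidef.mul_mul_conjTranspose_same (posSemidef_diagonal_iff.mpr fun i => ?_) _
  rw [Complex.zero_le_real, sub_nonneg, hε, inv_mul_le_iff₀ hpos, mul_one]
  have := Finset.single_le_sum (f := fun i => |d i|) (fun i _ => abs_nonneg _) (Finset.mem_univ i)
  linarith [le_abs_self (d i)]

lemma lyapunovMatrix_add_smul_one_add (ε : ℝ) :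
    lyapunovMatrix H (A + (ε : ℂ) • (1 : Matrix (Fin n) (Fin n) ℂ)) B C D +
      fromBlocks ((2 * ε : ℂ) • H) 0 0 0 = lyapunovMatrix H A B C D := by
  simp only [lyapunovMatrix, fromBlocks_conjTranspose, fromBlocks_multiply, fromBlocks_add]
  congr 1
  · simp only [Matrix.mul_add, Matrix.add_mul, conjTranspose_add, conjTranspose_smul,
      conjTranspose_one, Complex.star_def, Complex.conj_ofReal, Matrix.mul_smul, Matrix.smul_mul,
      Matrix.mul_one, Matrix.one_mul, Matrix.mul_zero, Matrix.zero_mul, two_mul, add_smul,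
      Matrix.neg_mul, Matrix.mul_neg, smul_neg, add_zero]
    abel
  all_goals simp

lemma posSemidef_fromBlocks_zero {Δ : Matrix (Fin n) (Fin n) ℂ} (h : Δ.PosSemidef) :
    (fromBlocks Δ 0 0 (0 : Matrix (Fin m) (Fin m) ℂ)).PosSemidef := by
  refine PosSemidef.of_dotProduct_mulVec_nonneg
    (h.1.fromBlocks (by simp) isHermitian_zero) fun w => ?_
  have h1 := h.dotProduct_mulVec_nonneg (w ∘ Sum.inl)
  rw [fromBlocks_mulVec, zero_mulVec, zero_mulVec, zero_mulVec, add_zero, add_zero,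
    dotProduct, Fintype.sum_sum_type]
  simpa [dotProduct] using h1

theorem isStrictlyPositiveReal_of_posSemidef (hR : IsRealization F A B C D) (hH : H.PosDef)
    {Q₁ : Matrix (Fin n ⊕ Fin m) (Fin n ⊕ Fin m) ℂ} {Δ : Matrix (Fin n) (Fin n) ℂ}
    (hQ₁ : Q₁.PosSemidef) (hΔ : Δ.PosDef)
    (hQ : lyapunovMatrix H A B C D = Q₁ + fromBlocks Δ 0 0 0) : IsStrictlyPositiveReal F := by
  obtain ⟨ε, hε, hs⟩ := exists_pos_posSemidef_sub_smul hΔ hH.1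
  -- A shift by `ε / 2` costs `ε H` in the upper left block, which `Δ` can absorb.
  refine ⟨ε / 2, by positivity, isPositiveReal_of_posSemidef (hR.shift _) hH ?_⟩
  have h1 : lyapunovMatrix H (A + ((ε / 2 : ℝ) : ℂ) • (1 : Matrix (Fin n) (Fin n) ℂ)) B C D =
      Q₁ + fromBlocks (Δ - (ε : ℂ) • H) 0 0 0 := by
    have h2 := lyapunovMatrix_add_smul_one_add (H := H) (A := A) (B := B) (C := C) (D := D) (ε / 2)
    have h3 : (2 * ((ε / 2 : ℝ) : ℂ)) = ε := by push_cast; ring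
    rw [h3] at h2
    refine add_right_cancel (h2.trans ?_)
    rw [hQ, add_assoc, fromBlocks_add, sub_add_cancel]
    simp
  rw [h1]
  exact hQ₁.add (posSemidef_fromBlocks_zero hs)

/-! ### Necessity for minimal realizations -/

lemma lyapunovMatrix_mulVec (x : Fin n → ℂ) (u : Fin m → ℂ) :
    lyapunovMatrix H A B C D *ᵥ Sum.elim x u =
      Sum.elim (-(H *ᵥ (A *ᵥ x + B *ᵥ u)) - Aᴴ *ᵥ (H *ᵥ x) + Cᴴ *ᵥ u)
        (C *ᵥ x + D *ᵥ u - Bᴴ *ᵥ (H *ᵥ x) + Dᴴ *ᵥ u) := by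
  rw [lyapunovMatrix, add_mulVec, ← mulVec_mulVec, ← mulVec_mulVec, fromBlocks_conjTranspose]
  simp only [fromBlocks_mulVec, Sum.elim_comp_inl, Sum.elim_comp_inr, zero_mulVec, neg_mulVec,
    add_zero, zero_add, one_mulVec, mulVec_neg]
  ext i
  cases i <;> simp [sub_eq_add_neg, add_assoc]

/-- The form vanishes at `(x, 0)`, so semidefiniteness puts this vector in the kernel, and the two
blocks can be read off. Thus the kernel of `H` is an `A`-invariant subspace of the kernel of `C`, as
observability requires. -/
lemma mulVec_eq_zero_of_posSemidef_lyapunovMatrix (hH : H.IsHermitian)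
    (hQ : (lyapunovMatrix H A B C D).PosSemidef) {x : Fin n → ℂ} (hx : H *ᵥ x = 0) :
    H *ᵥ (A *ᵥ x) = 0 ∧ C *ᵥ x = 0 := by
  have h1 : star x ⬝ᵥ H *ᵥ (A *ᵥ x) = 0 := by
    rw [dotProduct_mulVec, ← hH.eq, vecMul_conjTranspose, star_star, hx]; simp
  have h0 : lyapunovMatrix H A B C D *ᵥ Sum.elim x 0 = 0 := by
    rw [← hQ.dotProduct_mulVec_zero_iff, star_dotProduct_lyapunovMatrix_mulVec]
    simp only [hx, mulVec_zero, add_zero, h1, dotProduct_zero, star_zero, zero_dotProduct, sub_zero]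
  rw [lyapunovMatrix_mulVec, hx] at h0
  constructor
  · ext i
    simpa using congrFun h0 (Sum.inl i)
  · ext i
    simpa using congrFun h0 (Sum.inr i)

/-- The homogeneous inequality has only the trivial solution when `(A, B)` is controllable. -/
lemma IsControllable.eq_zero (hcon : IsControllable A B) (hH : H.IsHermitian)
    (hQ : (lyapunovMatrix H A B (0 : Matrix (Fin m) (Fin n) ℂ) 0).PosSemidef) : H = 0 := by
  have hV : LinearMap.ker H.mulVecLin = ⊤ := by
    refine hcon _ (fun u => ?_) (fun v hv => ?_)
    · have h0 : lyapunovMatrix H A B (0 : Matrix (Fin m) (Fin n) ℂ) 0 *ᵥ Sum.elim 0 u = 0 := by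
        rw [← hQ.dotProduct_mulVec_zero_iff, star_dotProduct_lyapunovMatrix_mulVec]
        simp
      rw [lyapunovMatrix_mulVec] at h0
      rw [LinearMap.mem_ker, mulVecLin_apply]
      ext i
      simpa using congrFun h0 (Sum.inl i)
    · rw [LinearMap.mem_ker, mulVecLin_apply] at hv ⊢
      exact (mulVec_eq_zero_of_posSemidef_lyapunovMatrix hH hQ hv).1
  have h1 : H.mulVecLin = 0 := LinearMap.ker_eq_top.mp hV
  ext i j
  have := congrFun (LinearMap.congr_fun h1 (Pi.single j 1)) i
  simpa using this

lemma IsObservable.posDef (hobs : IsObservable A C) (hH : H.PosSemidef)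
    (hQ : (lyapunovMatrix H A B C D).PosSemidef) : H.PosDef := by
  have hV : LinearMap.ker H.mulVecLin = ⊥ := by
    refine hobs _ (fun v hv => ?_) (fun v hv => ?_)
    · rw [LinearMap.mem_ker, mulVecLin_apply] at hv
      exact (mulVec_eq_zero_of_posSemidef_lyapunovMatrix hH.1 hQ hv).2
    · rw [LinearMap.mem_ker, mulVecLin_apply] at hv ⊢
      exact (mulVec_eq_zero_of_posSemidef_lyapunovMatrix hH.1 hQ hv).1
  refine PosDef.of_dotProduct_mulVec_pos hH.1 fun x hx =>
    lt_of_le_of_ne (hH.dotProduct_mulVec_nonneg x) fun h => hx ?_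
  have : x ∈ LinearMap.ker H.mulVecLin := (hH.dotProduct_mulVec_zero_iff x).mp h.symm
  rwa [hV, Submodule.mem_bot] at this

lemma posSemidef_of_posSemidef_lyapunovMatrix (hH : H.IsHermitian)
    (hA : ∀ (l : ℂ) (x : Fin n → ℂ), x ≠ 0 → A *ᵥ x = l • x → l.re < 0)
    (hQ : (lyapunovMatrix H A B C D).PosSemidef) : H.PosSemidef := by
  refine posSemidef_of_lyapunov hH hA fun x => ?_
  have h1 := re_dotProduct_nonneg hQ (Sum.elim x 0)
  rw [re_lyapunovMatrix_zero_right] at h1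
  linarith

/-- Absence of poles in the closed half-plane makes `A` stable, and the limit at infinity must be
`D`. The strict lemma then yields a Hermitian `H`, whose definiteness follows from stability and
observability. -/
theorem exists_posDef_of_isHyperPositiveReal (hR : IsRealization F A B C D)
    (hcon : IsControllable A B) (hobs : IsObservable A C) (hF : IsHyperPositiveReal F) :
    ∃ H : Matrix (Fin n) (Fin n) ℂ, H.PosDef ∧ (lyapunovMatrix H A B C D).PosDef := by
  obtain ⟨hF, L, hL, hlim⟩ := hF
  have hLD : L = D := tendsto_nhds_unique hlim hR.tendsto_value
  subst hLD
  have hA : ∀ (l : ℂ) (x : Fin n → ℂ), x ≠ 0 → A *ᵥ x = l • x → l.re < 0 := by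
    intro l x hx h
    by_contra! hl
    exact hR.not_analyticAtPoint hcon hobs hx h (hF l hl).1
  obtain ⟨H, hH, hQ⟩ := exists_lyapunovMatrix_posDef (A := A) (B := B) (C := C) (D := L)
    (fun ω x h => by
      by_contra hx
      have := hA _ x hx h
      simp at this)
    (fun ω x u hu h => by
      have hU : IsUnit ((Complex.I * ω) • (1 : Matrix (Fin n) (Fin n) ℂ) - A) :=
        isUnit_of_forall_eigenvalue fun x hx h => by
          have := hA _ x hx h
          simp at this
      rw [← hR.value_mulVec hU h]
      exact mem_lyapOpen_iff.mp (hF _ (by simp)).2 u hu)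
    (fun u hu => mem_lyapOpen_iff.mp hL u hu)
  have hH' := posSemidef_of_posSemidef_lyapunovMatrix hH hA hQ.posSemidef
  exact ⟨H, hobs.posDef hH' hQ.posSemidef, hQ⟩

lemma isClosed_posSemidef {ι : Type*} [Fintype ι] :
    IsClosed {M : Matrix ι ι ℂ | M.PosSemidef} := by
  simp only [posSemidef_iff_dotProduct_mulVec, Set.ofPred_and, Set.ofPred_forall]
  refine (isClosed_eq (by fun_prop) continuous_id).inter (isClosed_iInter fun x => ?_)
  exact isClosed_le continuous_const (by fun_prop)

lemma smul_lyapunovMatrix (c : ℝ) :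
    lyapunovMatrix (c • H) A B (c • C) (c • D) = c • lyapunovMatrix H A B C D := by
  simp only [lyapunovMatrix, fromBlocks_conjTranspose, fromBlocks_multiply, fromBlocks_add,
    fromBlocks_smul]
  congr 1 <;> simp [smul_add]

lemma continuous_lyapunovMatrix :
    Continuous fun p : Matrix (Fin n) (Fin n) ℂ × Matrix (Fin n) (Fin n) ℂ ×
      Matrix (Fin m) (Fin n) ℂ × Matrix (Fin m) (Fin m) ℂ =>
        lyapunovMatrix p.1 p.2.1 B p.2.2.1 p.2.2.2 := by
  have h1 : Continuous fun p : Matrix (Fin n) (Fin n) ℂ × Matrix (Fin n) (Fin n) ℂ ×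
      Matrix (Fin m) (Fin n) ℂ × Matrix (Fin m) (Fin m) ℂ =>
        fromBlocks (-p.1) 0 0 (1 : Matrix (Fin m) (Fin m) ℂ) :=
    Continuous.matrix_fromBlocks (by fun_prop) (by fun_prop) (by fun_prop) (by fun_prop)
  have h2 : Continuous fun p : Matrix (Fin n) (Fin n) ℂ × Matrix (Fin n) (Fin n) ℂ ×
      Matrix (Fin m) (Fin n) ℂ × Matrix (Fin m) (Fin m) ℂ =>
        fromBlocks p.2.1 B p.2.2.1 p.2.2.2 :=
    Continuous.matrix_fromBlocks (by fun_prop) (by fun_prop) (by fun_prop) (by fun_prop)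
  exact (h1.matrix_mul h2).add (h2.matrix_conjTranspose.matrix_mul h1)

lemma mem_lyapClosed_feedthrough (hR : IsRealization F A B C D) (hF : IsPositiveReal F) :
    D ∈ lyapClosed m := by
  refine mem_lyapClosed_iff.mpr fun u => ?_
  have h1 : Filter.Tendsto (fun r : ℝ => F.value (r : ℂ)) Filter.atTop (𝓝 D) :=
    hR.tendsto_value.comp (RCLike.tendsto_ofReal_atTop_cobounded ℂ)
  have hc : Continuous fun M : Matrix (Fin m) (Fin m) ℂ => (star u ⬝ᵥ M *ᵥ u).re := by fun_prop
  refine ge_of_tendsto ((hc.tendsto D).comp h1) ?_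
  filter_upwards [Filter.eventually_gt_atTop 0] with r hr
  exact mem_lyapClosed_iff.mp (hF r (by simpa using hr)).2 u

/-- Solvability of the regularized inequality. -/
lemma exists_posSemidef_regularized (hR : IsRealization F A B C D)
    (hcon : IsControllable A B) (hobs : IsObservable A C) (hF : IsPositiveReal F) {ε : ℝ}
    (hε : 0 < ε) :
    ∃ H : Matrix (Fin n) (Fin n) ℂ, H.PosSemidef ∧
      (lyapunovMatrix H (A - (ε : ℂ) • (1 : Matrix (Fin n) (Fin n) ℂ)) B C
        (D + (ε : ℂ) • (1 : Matrix (Fin m) (Fin m) ℂ))).PosSemidef := by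
  have hA : ∀ (l : ℂ) (x : Fin n → ℂ), x ≠ 0 → A *ᵥ x = l • x → l.re ≤ 0 := by
    intro l x hx h
    by_contra! hl
    exact hR.not_analyticAtPoint hcon hobs hx h (hF l hl).1
  have hAε : ∀ (l : ℂ) (x : Fin n → ℂ), x ≠ 0 →
      (A - (ε : ℂ) • (1 : Matrix (Fin n) (Fin n) ℂ)) *ᵥ x = l • x → l.re < 0 := by
    intro l x hx h
    rw [sub_mulVec, smul_mulVec, one_mulVec, sub_eq_iff_eq_add, ← add_smul] at h
    have := hA _ x hx h
    rw [Complex.add_re, Complex.ofReal_re] at this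
    linarith
  have hD := mem_lyapClosed_iff.mp (mem_lyapClosed_feedthrough hR hF)
  have hu0 : ∀ u : Fin m → ℂ, u ≠ 0 → 0 < (star u ⬝ᵥ (ε : ℂ) • u).re := by
    intro u hu
    rw [dotProduct_smul, smul_eq_mul, Complex.re_ofReal_mul]
    exact mul_pos hε (Complex.pos_iff.mp (dotProduct_star_self_pos_iff.mpr hu)).1
  obtain ⟨H, hH, hQ⟩ := exists_lyapunovMatrix_posDef
    (A := A - (ε : ℂ) • (1 : Matrix (Fin n) (Fin n) ℂ)) (B := B) (C := C)
    (D := D + (ε : ℂ) • (1 : Matrix (Fin m) (Fin m) ℂ))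
    (fun ω x h => by
      by_contra hx
      have := hAε _ x hx h
      simp at this)
    -- A pair at frequency `iω` for `A - ε` is a pair at `ε + iω` for `A`, inside the domain of
    -- positivity; the term added to `D` supplies strictness.
    (fun ω x u hu h => by
      have hs : 0 < ((ε : ℂ) + Complex.I * ω).re := by simpa using hε
      have hU : IsUnit (((ε : ℂ) + Complex.I * ω) • (1 : Matrix (Fin n) (Fin n) ℂ) - A) :=
        isUnit_of_forall_eigenvalue fun x hx h => absurd (hA _ x hx h) (not_le.mpr hs)
      have hx : A *ᵥ x + B *ᵥ u = ((ε : ℂ) + Complex.I * ω) • x := by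
        rw [add_smul, ← h, sub_mulVec, smul_mulVec, one_mulVec]
        abel
      rw [add_mulVec, smul_mulVec, one_mulVec, ← add_assoc, ← hR.value_mulVec hU hx,
        dotProduct_add, Complex.add_re]
      exact add_pos_of_nonneg_of_pos (mem_lyapClosed_iff.mp (hF _ hs).2 u) (hu0 u hu))
    (fun u hu => by
      rw [add_mulVec, smul_mulVec, one_mulVec, dotProduct_add, Complex.add_re]
      exact add_pos_of_nonneg_of_pos (hD u) (hu0 u hu))
  exact ⟨H, posSemidef_of_posSemidef_lyapunovMatrix hH hAε hQ.posSemidef, hQ.posSemidef⟩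

open scoped Matrix.Norms.Elementwise in
/-- The positive real lemma. -/
theorem exists_posDef_of_isPositiveReal (hR : IsRealization F A B C D)
    (hcon : IsControllable A B) (hobs : IsObservable A C) (hF : IsPositiveReal F) :
    ∃ H : Matrix (Fin n) (Fin n) ℂ, H.PosDef ∧ (lyapunovMatrix H A B C D).PosSemidef := by
  set ε : ℕ → ℝ := fun k => 1 / ((k : ℝ) + 1) with hεdef
  have hε : ∀ k, 0 < ε k := fun k => Nat.one_div_pos_of_nat
  have hεlim : Filter.Tendsto ε Filter.atTop (𝓝 0) := tendsto_one_div_add_atTop_nhds_zero_nat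
  choose H hH hQ using fun k => exists_posSemidef_regularized hR hcon hobs hF (hε k)
  -- The solutions `H k` may be unbounded. The inequality is homogeneous in `(H, C, D)`, so it is
  -- scaled to give `c k + ‖G k‖ = 1` and a subsequence converges.
  set c : ℕ → ℝ := fun k => (1 + ‖H k‖)⁻¹ with hcdef
  have hc : ∀ k, 0 < c k := fun k => inv_pos.mpr (by positivity)
  set G : ℕ → Matrix (Fin n) (Fin n) ℂ := fun k => c k • H k with hGdef
  have hsum : ∀ k, c k + ‖G k‖ = 1 := by
    intro k
    have : (1 + ‖H k‖) ≠ 0 := by positivity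
    rw [hGdef, norm_smul, Real.norm_of_nonneg (hc k).le, hcdef]
    field_simp
  have hmem : ∀ k, (c k, G k) ∈ Metric.closedBall (0 : ℝ × Matrix (Fin n) (Fin n) ℂ) 1 := by
    intro k
    rw [mem_closedBall_zero_iff, Prod.norm_mk, max_le_iff, Real.norm_of_nonneg (hc k).le]
    constructor <;> linarith [hsum k, norm_nonneg (G k), hc k]
  obtain ⟨⟨c₀, G₀⟩, -, φ, hφ, hlim⟩ := (isCompact_closedBall _ _).tendsto_subseq hmem
  have hclim : Filter.Tendsto (fun k => c (φ k)) Filter.atTop (𝓝 c₀) :=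
    (continuous_fst.tendsto _).comp hlim
  have hGlim : Filter.Tendsto (fun k => G (φ k)) Filter.atTop (𝓝 G₀) :=
    (continuous_snd.tendsto _).comp hlim
  have hεlim' : Filter.Tendsto (fun k => ε (φ k)) Filter.atTop (𝓝 0) :=
    hεlim.comp hφ.tendsto_atTop
  have hsum₀ : c₀ + ‖G₀‖ = 1 :=
    tendsto_nhds_unique (hclim.add hGlim.norm) (by simp only [hsum]; exact tendsto_const_nhds)
  have hc₀ : 0 ≤ c₀ := ge_of_tendsto' hclim fun k => (hc _).le
  have hG₀ : G₀.PosSemidef :=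
    isClosed_posSemidef.mem_of_tendsto hGlim
      (Filter.Eventually.of_forall fun k => (hH (φ k)).smul (hc _).le)
  have hQ₀ : (lyapunovMatrix G₀ A B (c₀ • C) (c₀ • D)).PosSemidef := by
    have hcont : Continuous fun p : ℝ × ℝ × Matrix (Fin n) (Fin n) ℂ =>
        lyapunovMatrix p.2.2 (A - (p.1 : ℂ) • (1 : Matrix (Fin n) (Fin n) ℂ)) B (p.2.1 • C)
          (p.2.1 • (D + (p.1 : ℂ) • (1 : Matrix (Fin m) (Fin m) ℂ))) :=
      continuous_lyapunovMatrix.comp (g := fun p : Matrix (Fin n) (Fin n) ℂ ×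
        Matrix (Fin n) (Fin n) ℂ × Matrix (Fin m) (Fin n) ℂ × Matrix (Fin m) (Fin m) ℂ =>
          lyapunovMatrix p.1 p.2.1 B p.2.2.1 p.2.2.2) (f := fun p : ℝ × ℝ × Matrix (Fin n) (Fin n) ℂ =>
          (p.2.2, A - (p.1 : ℂ) • (1 : Matrix (Fin n) (Fin n) ℂ), p.2.1 • C,
            p.2.1 • (D + (p.1 : ℂ) • (1 : Matrix (Fin m) (Fin m) ℂ)))) (by fun_prop)
    have h1 := (hcont.tendsto (0, c₀, G₀)).comp (hεlim'.prodMk_nhds (hclim.prodMk_nhds hGlim))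
    have h2 := isClosed_posSemidef.mem_of_tendsto h1 (Filter.Eventually.of_forall fun k => by
      change (lyapunovMatrix (c (φ k) • H (φ k)) _ B (c (φ k) • C) (c (φ k) • _)).PosSemidef
      rw [smul_lyapunovMatrix]
      exact (hQ (φ k)).smul (hc _).le)
    simpa using h2
  -- If `c₀ = 0`, the limit `G₀` has norm one and solves the homogeneous inequality, which
  -- controllability forbids.
  have hc₀' : 0 < c₀ := by
    refine lt_of_le_of_ne hc₀ fun h0 => ?_
    rw [← h0, zero_smul, zero_smul] at hQ₀
    rw [hcon.eq_zero hG₀.1 hQ₀, ← h0, norm_zero, add_zero] at hsum₀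
    exact zero_ne_one hsum₀
  have hH₀ : (c₀⁻¹ • G₀).PosSemidef := hG₀.smul (inv_nonneg.mpr hc₀)
  have hQH : (lyapunovMatrix (c₀⁻¹ • G₀) A B C D).PosSemidef := by
    have h1 := smul_lyapunovMatrix (H := G₀) (A := A) (B := B) (C := c₀ • C) (D := c₀ • D) c₀⁻¹
    rw [smul_smul, smul_smul, inv_mul_cancel₀ hc₀'.ne', one_smul, one_smul] at h1
    rw [h1]
    exact hQ₀.smul (inv_nonneg.mpr hc₀)
  exact ⟨_, hobs.posDef hH₀ hQH, hQH⟩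

theorem exists_posDef_of_isStrictlyPositiveReal (hR : IsRealization F A B C D)
    (hcon : IsControllable A B) (hobs : IsObservable A C) (hF : IsStrictlyPositiveReal F) :
    ∃ H : Matrix (Fin n) (Fin n) ℂ, H.PosDef ∧
      ∃ (Q₁ : Matrix (Fin n ⊕ Fin m) (Fin n ⊕ Fin m) ℂ) (Δ : Matrix (Fin n) (Fin n) ℂ),
        Q₁.PosSemidef ∧ Δ.PosDef ∧ lyapunovMatrix H A B C D = Q₁ + fromBlocks Δ 0 0 0 := by
  obtain ⟨ε, hε, hF⟩ := hF
  obtain ⟨H, hH, hQ⟩ := exists_posDef_of_isPositiveReal (hR.shift ε) (hcon.add_smul_one _)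
    (hobs.add_smul_one _) hF
  -- Undoing the shift adds `2εH`, and this serves as `Δ`.
  refine ⟨H, hH, _, (2 * ε : ℂ) • H, hQ, hH.smul ?_, ?_⟩
  · exact_mod_cast mul_pos two_pos hε
  · exact (lyapunovMatrix_add_smul_one_add ε).symm

end KYP

theorem mainTheorem5 (n m : ℕ) (F : KYP.RatMat m)
    (A : Matrix (Fin n) (Fin n) ℂ) (B : Matrix (Fin n) (Fin m) ℂ)
    (C : Matrix (Fin m) (Fin n) ℂ) (D : Matrix (Fin m) (Fin m) ℂ)
    (hR : KYP.IsRealization F A B C D) :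
    (∀ H : Matrix (Fin n) (Fin n) ℂ, H.PosDef →
      ((KYP.lyapunovMatrix H A B C D).PosSemidef → KYP.IsPositiveReal F) ∧
      ((∃ (Q₁ : Matrix (Fin n ⊕ Fin m) (Fin n ⊕ Fin m) ℂ) (Δ : Matrix (Fin n) (Fin n) ℂ),
          Q₁.PosSemidef ∧ Δ.PosDef ∧
          KYP.lyapunovMatrix H A B C D = Q₁ + Matrix.fromBlocks Δ 0 0 0) →
        KYP.IsStrictlyPositiveReal F) ∧
      ((KYP.lyapunovMatrix H A B C D).PosDef → KYP.IsHyperPositiveReal F)) ∧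
    (n = KYP.mcMillanDegree F →
      (KYP.IsPositiveReal F →
        ∃ H : Matrix (Fin n) (Fin n) ℂ, H.PosDef ∧
          (KYP.lyapunovMatrix H A B C D).PosSemidef) ∧
      (KYP.IsStrictlyPositiveReal F →
        ∃ H : Matrix (Fin n) (Fin n) ℂ, H.PosDef ∧
          ∃ (Q₁ : Matrix (Fin n ⊕ Fin m) (Fin n ⊕ Fin m) ℂ) (Δ : Matrix (Fin n) (Fin n) ℂ),
            Q₁.PosSemidef ∧ Δ.PosDef ∧
            KYP.lyapunovMatrix H A B C D = Q₁ + Matrix.fromBlocks Δ 0 0 0) ∧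
      (KYP.IsHyperPositiveReal F →
        ∃ H : Matrix (Fin n) (Fin n) ℂ, H.PosDef ∧
          (KYP.lyapunovMatrix H A B C D).PosDef)) := by
  refine ⟨fun H hH => ⟨KYP.isPositiveReal_of_posSemidef hR hH, ?_,
    KYP.isHyperPositiveReal_of_posDef hR hH⟩, fun hn => ?_⟩
  · rintro ⟨Q₁, Δ, hQ₁, hΔ, hQ⟩
    exact KYP.isStrictlyPositiveReal_of_posSemidef hR hH hQ₁ hΔ hQ
  · have hcon := hR.isControllable hn
    have hobs := hR.isObservable hn
    exact ⟨KYP.exists_posDef_of_isPositiveReal hR hcon hobs,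
      KYP.exists_posDef_of_isStrictlyPositiveReal hR hcon hobs,
      KYP.exists_posDef_of_isHyperPositiveReal hR hcon hobs⟩
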